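/- Let $k$ be a field of characteristic zero and $\mathcal H$ a Hopf algebra over $k$ with bijective antipode $S$, coproduct $\Delta h=h^{(0)}\otimes h^{(1)}$ and counit $\epsilon$. A left $\mathcal H$-algebra is a unital $k$-algebra $A$ that is a left $\mathcal H$-module with $h\cdot(ab)=(h^{(0)}\cdot a)(h^{(1)}\cdot b)$ and $h\cdot 1=\epsilon(h)1$. Let $F(\mathcal H)=\mathrm{Hom}_k(\mathcal H,k)$, and let $C^n_{\mathcal H}(A)$ be the space of $(n+1)$-linear maps $f:A^{n+1}\to F(\mathcal H)$ that are $\mathcal H$-equivariant: $$f(h^{(0)}\cdot a_0,\dots,h^{(n)}\cdot a_n)(g)=f(a_0,\dots,a_n)(S(h^{(1)})\,g\,h^{(0)})\qquad (h,g\in\mathcal H,\ a_i\in A).$$ With the cyclic operator $(Tf)(a_0,\dots,a_n)(g)=f(S^{-1}(g^{(0)})\cdot a_n,a_0,\dots,a_{n-1})(g^{(1)})$ and the Hochschild coboundary $$(bf)(a_0,\dots,a_{n+1})(g)=\sum_{i=0}^{n}(-1)^if(a_0,\dots,a_ia_{i+1},\dots,a_{n+1})(g)+(-1)^{n+1}f\big((S^{-1}(g^{(0)})\cdot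 a_{n+1})a_0,a_1,\dots,a_n\big)(g^{(1)}),$$ the equivariant cyclic cohomology $HC^n_{\mathcal H}(A)$ is the $n$-th cohomology of the complex of those $f\in C^n_{\mathcal H}(A)$ with $Tf=(-1)^nf$, with differential $b$. A Yetter–Drinfeld $\mathcal H$-algebra is a left $\mathcal H$-algebra $A$ with a right $\mathcal H$-comodule structure $\rho(a)=a_{<0>}\otimes a_{<1>}\in A\otimes\mathcal H$ such that $\rho(1)=1\otimes1$, $\rho(ab)=a_{<0>}b_{<0>}\otimes b_{<1>}a_{<1>}$ and $(h^{(1)}\cdot a)_{<0>}\otimes(h^{(1)}\cdot a)_{<1>}h^{(0)}=h^{(0)}\cdot a_{<0>}\otimes h^{(1)}a_{<1>}$. For such $A$ and a representation $r:\mathcal H\to\mathrm{End}(V)$, $A\otimes\mathrm{End}(V)$ is the $\mathcal H$-algebra with multiplication $(a\otimes u)(c\otimes v)=ac_{<0>}\otimes(c_{<1>}\cdot u)v$ and diagonal action, where $\mathcal H$ acts on $\mathrm{End}(V)$ by $h\cdot u=r(h^{(0)})\,u\,r(S(h^{(1)}))$. **Morita invariance.** Let $V$ be a nonzero finite-dimensional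 trivial $\mathcal H$-module, that is, $h\cdot v=\epsilon(h)v$. Then, for every $n\ge0$: 1. for every Yetter–Drinfeld $\mathcal H$-algebra $A$ there is a $k$-linear isomorphism $HC^n_{\mathcal H}(A)\cong HC^n_{\mathcal H}(A\otimes\mathrm{End}(V))$; 2. for every left $\mathcal H$-algebra $A$ there is a $k$-linear isomorphism $HC^n_{\mathcal H}(A)\cong HC^n_{\mathcal H}(A\otimes\mathrm{End}(V))$, where $A\otimes\mathrm{End}(V)$ has the tensor product multiplication and the action $h\cdot(a\otimes u)=(h\cdot a)\otimes u$. In both cases the isomorphism is induced by the trace map: it sends the class of a cyclic cocycle $f$ to the class of a cyclic cocycle whose value on elements $a_i\otimes u_i$ is $$(a_0\otimes u_0,\dots,a_n\otimes u_n)\mapsto\big(g\mapsto \mathrm{tr}(u_0u_1\cdots u_n)\,f(a_0,\dots,a_n)(g)\big).$$ -/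

import Mathlib

open scoped TensorProduct

noncomputable section

namespace EquivariantCyclic

open TensorProduct Coalgebra HopfAlgebra

section HAlgebras

variable (k : Type*) [Field k] (H : Type*) [Ring H] [HopfAlgebra k H]

/-- A left `H`-algebra structure on the unital algebra `A`: a left `H`-module structure, given by
its structure map `H → End A`, with `h · 1 = ε(h) 1` and
`h · (a b) = (h⁽⁰⁾ · a) (h⁽¹⁾ · b)`. -/
structure HAlgebra (A : Type*) [Ring A] [Algebra k A] where
  /-- The structure map of the `H`-module `A`. -/
  act : H →ₐ[k] Module.End k A
  act_one : ∀ h : H, act h 1 = counit (R := k) h • (1 : A)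
  act_mul : ∀ (h : H) (a b : A), act h (a * b) =
    LinearMap.mul' k A (map₂ act.toLinearMap act.toLinearMap (comul (R := k) h) (a ⊗ₜ[k] b))

variable {k H}

/-- The `H`-algebra `A ⊗ B` with the tensor product multiplication and with `H` acting on the
first factor only: `h · (a ⊗ b) = (h · a) ⊗ b`. -/
def HAlgebra.tensorRight {A : Type*} [Ring A] [Algebra k A] (hA : HAlgebra k H A)
    (B : Type*) [Ring B] [Algebra k B] : HAlgebra k H (A ⊗[k] B) where
  act := (Module.End.rTensorAlgHom k A B).comp hA.act
  act_one h := by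
    change hA.act h 1 ⊗ₜ[k] (1 : B) = _
    rw [hA.act_one, ← smul_tmul', Algebra.TensorProduct.one_def]
  act_mul h x y := by
    induction x with
    | zero => simp
    | add x x' hx hx' => simp only [add_mul, map_add, hx, hx', add_tmul]
    | tmul a b =>
    induction y with
    | zero => simp
    | add y y' hy hy' => simp only [mul_add, map_add, hy, hy', tmul_add]
    | tmul c d =>
    have key : ∀ t : H ⊗[k] H,
        LinearMap.mul' k A (map₂ hA.act.toLinearMap hA.act.toLinearMap t (a ⊗ₜ[k] c)) ⊗ₜ[k] (b * d)
        = LinearMap.mul' k (A ⊗[k] B) (map₂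
          ((Module.End.rTensorAlgHom k A B).comp hA.act).toLinearMap
          ((Module.End.rTensorAlgHom k A B).comp hA.act).toLinearMap t
          ((a ⊗ₜ[k] b) ⊗ₜ[k] (c ⊗ₜ[k] d))) := by
      intro t
      induction t with
      | zero => simp
      | add t t' ht ht' => simp only [map_add, LinearMap.add_apply, add_tmul, ht, ht']
      | tmul x y => exact (Algebra.TensorProduct.tmul_mul_tmul _ _ _ _).symm
    rw [← key, ← hA.act_mul, Algebra.TensorProduct.tmul_mul_tmul]
    rfl

/-- A Sweedler representation of `Δ h`. -/
theorem comul_sum (h : H) : comul (R := k) h =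
    ∑ i ∈ (ℛ k h).index, (ℛ k h).left i ⊗ₜ[k] (ℛ k h).right i :=
  (ℛ k h).eq.symm

/-- Coassociativity in Sweedler notation. -/
theorem sum_coassoc {M : Type*} [AddCommGroup M] [Module k M]
    (Φ : H →ₗ[k] H →ₗ[k] H →ₗ[k] M) (h : H) :
    ∑ i ∈ (ℛ k h).index, ∑ j ∈ (ℛ k ((ℛ k h).left i)).index,
      Φ ((ℛ k ((ℛ k h).left i)).left j) ((ℛ k ((ℛ k h).left i)).right j) ((ℛ k h).right i) =
    ∑ i ∈ (ℛ k h).index, ∑ j ∈ (ℛ k ((ℛ k h).right i)).index,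
      Φ ((ℛ k h).left i) ((ℛ k ((ℛ k h).right i)).left j)
        ((ℛ k ((ℛ k h).right i)).right j) := by
  have := congrArg (lift (TensorProduct.uncurry (.id k) H H M ∘ₗ Φ))
    (coassoc_apply (R := k) h)
  simpa [comul_sum, sum_tmul, tmul_sum] using this

/-- The `H`-algebra `End V` of a representation `r : H → End V`, with the conjugation action
`h · u = r(h⁽⁰⁾) ∘ u ∘ r(S(h⁽¹⁾))`. -/
def HAlgebra.conjEnd {V : Type*} [AddCommGroup V] [Module k V] (r : H →ₐ[k] Module.End k V) :
    HAlgebra k H (Module.End k V) where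
  act := AlgHom.ofLinearMap
    (lift (LinearMap.mk₂ k
      (fun x y : H => LinearMap.mulLeft k (r x) * LinearMap.mulRight k (r (antipode k y)))
      (by intros; ext; simp [add_mul]) (by intros; ext; simp)
      (by intros; ext; simp) (by intros; ext; simp)) ∘ₗ comul)
    (by ext; simp [Algebra.TensorProduct.one_def])
    (by
      intro g h
      simp only [LinearMap.comp_apply, Bialgebra.comul_mul]
      generalize comul (R := k) g = s
      generalize comul (R := k) h = t
      induction s with
      | zero => simp
      | add s s' hs hs' => simp only [add_mul, map_add, hs, hs']
      | tmul x y =>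
      induction t with
      | zero => simp
      | add t t' ht ht' => simp only [mul_add, map_add, ht, ht']
      | tmul x' y' =>
        ext u v
        simp [antipode_mul_antidistrib])
  act_one h := by
    have := congrArg r (sum_mul_antipode_eq_algebraMap_counit (ℛ k h))
    simp only [map_sum, map_mul, AlgHom.commutes] at this
    simp only [AlgHom.ofLinearMap_apply, LinearMap.comp_apply, comul_sum, map_sum, lift.tmul,
      LinearMap.mk₂_apply, LinearMap.sum_apply, Module.End.mul_apply, LinearMap.mulLeft_apply,
      LinearMap.mulRight_apply, one_mul, this, Algebra.algebraMap_eq_smul_one]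
  act_mul h u v := by
    let C : H →ₗ[k] Module.End k V := lift (LinearMap.mk₂ k
      (fun x y : H => r x * v * r (antipode k y))
      (by intros; simp [add_mul]) (by intros; simp)
      (by intros; simp [mul_add]) (by intros; simp)) ∘ₗ comul
    have hC : ∀ h, C h = ∑ i ∈ (ℛ k h).index,
        r ((ℛ k h).left i) * v * r (antipode k ((ℛ k h).right i)) := by
      intro h
      simp [C, comul_sum]
    have h1 : ∀ h, ∑ i ∈ (ℛ k h).index, r (antipode k ((ℛ k h).left i)) * C ((ℛ k h).right i)
        = v * r (antipode k h) := by
      intro h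
      have h2 := sum_coassoc (k := k) (LinearMap.mk₂ k
        (fun x y => LinearMap.mulLeft k (r (antipode k x) * r y * v) ∘ₗ r.toLinearMap ∘ₗ antipode k)
        (by intros; ext; simp [add_mul]) (by intros; ext; simp)
        (by intros; ext; simp [add_mul, mul_add]) (by intros; ext; simp)) h
      simp only [LinearMap.mk₂_apply, LinearMap.comp_apply, LinearMap.mulLeft_apply,
        AlgHom.toLinearMap_apply] at h2
      have h3 : ∀ h, ∑ i ∈ (ℛ k h).index, r (antipode k ((ℛ k h).left i)) * r ((ℛ k h).right i)
          = algebraMap k _ (counit (R := k) h) := by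
        intro h
        have := congrArg r (sum_antipode_mul_eq_algebraMap_counit (ℛ k h))
        simpa only [map_sum, map_mul, AlgHom.commutes] using this
      simp only [← Finset.sum_mul, h3] at h2
      simp only [hC, Finset.mul_sum]
      simp only [mul_assoc] at h2 ⊢
      rw [← h2]
      conv_rhs => rw [← sum_counit_smul (ℛ k h)]
      simp [Finset.mul_sum, Algebra.algebraMap_eq_smul_one]
    have h4 := sum_coassoc (k := k) (LinearMap.mk₂ k
        (fun x y => LinearMap.mulLeft k (r x * u * r (antipode k y)) ∘ₗ C)
        (by intros; ext; simp [add_mul]) (by intros; ext; simp)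
        (by intros; ext; simp [add_mul, mul_add]) (by intros; ext; simp)) h
    simp only [LinearMap.mk₂_apply, LinearMap.comp_apply, LinearMap.mulLeft_apply] at h4
    simp only [mul_assoc, ← Finset.mul_sum, h1] at h4
    simp only [← mul_assoc, ← Finset.sum_mul] at h4
    simp only [hC] at h4
    simp only [mul_assoc] at h4
    simp only [AlgHom.ofLinearMap_apply, LinearMap.comp_apply, comul_sum, map_sum, lift.tmul,
      LinearMap.mk₂_apply, LinearMap.sum_apply, Module.End.mul_apply, LinearMap.mulLeft_apply,
      LinearMap.mulRight_apply, AlgHom.toLinearMap_apply, map₂_apply_tmul, map_tmul,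
      LinearMap.mul'_apply, mul_assoc]
    exact h4.symm

end HAlgebras

section YD
variable {k : Type*} [Field k] {H : Type*} [Ring H] [HopfAlgebra k H]
variable {A : Type*} [Ring A] [Algebra k A] 

/-- The data which turn the left `H`-algebra `A` into a Yetter-Drinfeld `H`-algebra: a right
`Hᵒᵖ`-comodule algebra structure `ρ(a) = a_<0> ⊗ a_<1>` which satisfies the Yetter-Drinfeld
condition. -/
structure YetterDrinfeld (hA : HAlgebra k H A) where
  /-- The coaction. -/
  coact : A →ₗ[k] A ⊗[k] H
  coassoc : TensorProduct.assoc k A H H ∘ₗ coact.rTensor H ∘ₗ coact =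
    (comul (R := k) (A := H)).lTensor A ∘ₗ coact
  lTensor_counit : ∀ a : A, (counit (R := k) (A := H)).lTensor A (coact a) = a ⊗ₜ[k] (1 : k)
  coact_one : coact 1 = 1 ⊗ₜ[k] 1
  /-- `ρ(a b) = a_<0> b_<0> ⊗ b_<1> a_<1>`. -/
  coact_mul : ∀ a b : A, coact (a * b) =
    map₂ (LinearMap.mul k A) (LinearMap.mul k H).flip (coact a) (coact b)
  /-- `(h⁽¹⁾ · a)_<0> ⊗ (h⁽¹⁾ · a)_<1> h⁽⁰⁾ = h⁽⁰⁾ · a_<0> ⊗ h⁽¹⁾ a_<1>`. -/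
  yetterDrinfeld : ∀ (h : H) (a : A),
    lift (LinearMap.mk₂ k
      (fun x y : H => ((LinearMap.mul k H).flip x).lTensor A (coact (hA.act y a)))
      (by intros; simp [LinearMap.lTensor_add]) (by intros; simp [LinearMap.lTensor_smul])
      (by intros; simp) (by intros; simp)) (comul (R := k) h) =
    map₂ hA.act.toLinearMap (LinearMap.mul k H) (comul (R := k) h) (coact a)

variable {hA : HAlgebra k H A} {B : Type*} [Ring B] [Algebra k B]

/-- `(c ⊗ h) ⊗ (a ⊗ b) ↦ a c ⊗ (h · b)`. -/
def HAlgebra.slide (hB : HAlgebra k H B) : A ⊗[k] H →ₗ[k] A ⊗[k] B →ₗ[k] A ⊗[k] B :=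
  map₂ (LinearMap.mul k A).flip hB.act.toLinearMap

/-- The twisted multiplication on `A ⊗ B`:
`(a ⊗ b) (c ⊗ d) = a c_<0> ⊗ (c_<1> · b) d`. -/
def YetterDrinfeld.twistedMul (ρ : YetterDrinfeld hA) (hB : HAlgebra k H B) :
    A ⊗[k] B →ₗ[k] A ⊗[k] B →ₗ[k] A ⊗[k] B :=
  (lift (LinearMap.mk₂ k
    (fun (c : A) (d : B) => ((LinearMap.mul k B).flip d).lTensor A ∘ₗ hB.slide (ρ.coact c))
    (by intros; ext; simp) (by intros; ext; simp)
    (by intros; ext; simp [LinearMap.lTensor_add])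
    (by intros; ext; simp [LinearMap.lTensor_smul]))).flip

theorem YetterDrinfeld.twistedMul_tmul (ρ : YetterDrinfeld hA) (hB : HAlgebra k H B)
    (w : A ⊗[k] B) (c : A) (d : B) : ρ.twistedMul hB w (c ⊗ₜ d) =
      ((LinearMap.mul k B).flip d).lTensor A (hB.slide (ρ.coact c) w) := by
  simp [twistedMul]

theorem YetterDrinfeld.twistedMul_tmul_tmul (ρ : YetterDrinfeld hA) (hB : HAlgebra k H B)
    (a c : A) (b d : B) : ρ.twistedMul hB (a ⊗ₜ b) (c ⊗ₜ d) =
      map (LinearMap.mulLeft k a) (LinearMap.mulRight k d ∘ₗ hB.act.toLinearMap.flip b)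
        (ρ.coact c) := by
  rw [twistedMul_tmul, HAlgebra.slide]
  generalize ρ.coact c = t
  induction t with
  | zero => simp
  | add t t' ht ht' => simp only [map_add, LinearMap.add_apply, ht, ht']
  | tmul x y => simp

theorem YetterDrinfeld.twistedMul_one (ρ : YetterDrinfeld hA) (hB : HAlgebra k H B)
    (w : A ⊗[k] B) : ρ.twistedMul hB w (1 ⊗ₜ 1) = w := by
  induction w with
  | zero => simp
  | add t t' ht ht' => simp only [map_add, LinearMap.add_apply, ht, ht']
  | tmul x y => simp [twistedMul_tmul_tmul, ρ.coact_one]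

theorem YetterDrinfeld.one_twistedMul (ρ : YetterDrinfeld hA) (hB : HAlgebra k H B)
    (w : A ⊗[k] B) : ρ.twistedMul hB (1 ⊗ₜ 1) w = w := by
  induction w with
  | zero => simp
  | add t t' ht ht' => simp only [map_add, ht, ht']
  | tmul c d =>
    have h := congrArg (map (LinearMap.id (R := k) (M := A))
      (LinearMap.toSpanSingleton k B d)) (ρ.lTensor_counit c)
    rw [twistedMul_tmul_tmul]
    have h2 : ∀ t : A ⊗[k] H, map (LinearMap.mulLeft k (1 : A))
        (LinearMap.mulRight k d ∘ₗ hB.act.toLinearMap.flip 1) t =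
        map (LinearMap.id (R := k) (M := A)) (LinearMap.toSpanSingleton k B d)
          ((counit (R := k) (A := H)).lTensor A t) := by
      intro t
      induction t with
      | zero => simp
      | add t t' ht ht' => simp only [map_add, ht, ht']
      | tmul x y => simp [hB.act_one]
    rw [h2, h]
    simp

theorem YetterDrinfeld.twistedMul_assoc (ρ : YetterDrinfeld hA) (hB : HAlgebra k H B)
    (x y z : A ⊗[k] B) : ρ.twistedMul hB (ρ.twistedMul hB x y) z =
      ρ.twistedMul hB x (ρ.twistedMul hB y z) := by
  induction z with
  | zero => simp
  | add t t' ht ht' => simp only [map_add, ht, ht']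
  | tmul e f =>
  induction y with
  | zero => simp
  | add t t' ht ht' => simp only [map_add, LinearMap.add_apply, ht, ht']
  | tmul c d =>
  induction x with
  | zero => simp
  | add t t' ht ht' => simp only [map_add, LinearMap.add_apply, ht, ht']
  | tmul a b =>
  -- both sides are the value of one linear map on the two expressions for the double coaction
  let Q : A ⊗[k] H →ₗ[k] A ⊗[k] (H ⊗[k] H) →ₗ[k] A ⊗[k] B :=
    lift (LinearMap.mk₂ k (fun (c' : A) (m : H) =>
      map (LinearMap.mulLeft k (a * c')) (lift (LinearMap.mk₂ k
        (fun p q : H => hB.act (p * m) b * hB.act q d * f)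
        (by intros; simp [add_mul]) (by intros; simp)
        (by intros; simp [add_mul, mul_add]) (by intros; simp))))
      (by intros; ext; simp [add_mul, mul_add, add_tmul, mul_assoc])
      (by intros; ext; simp [smul_tmul', mul_assoc])
      (by intros; ext; simp [add_mul, mul_add, tmul_add])
      (by intros; ext; simp))
  have hL : ∀ s t, ((LinearMap.mul k B).flip f).lTensor A (hB.slide t
      (((LinearMap.mul k B).flip d).lTensor A (hB.slide s (a ⊗ₜ b)))) =
      Q s ((comul (R := k) (A := H)).lTensor A t) := by
    intro s t
    induction s with
    | zero => simp
    | add s s' hs hs' => simp only [map_add, LinearMap.add_apply, hs, hs']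
    | tmul c' m =>
    induction t with
    | zero => simp
    | add s s' hs hs' => simp only [map_add, LinearMap.add_apply, hs, hs']
    | tmul e' n =>
      simp only [HAlgebra.slide, map₂_apply_tmul, map_tmul, LinearMap.lTensor_tmul, Q, lift.tmul,
        LinearMap.mk₂_apply, LinearMap.flip_apply, LinearMap.mul_apply', AlgHom.toLinearMap_apply,
        hB.act_mul, LinearMap.mulLeft_apply]
      generalize comul (R := k) n = u
      congr 1
      induction u with
      | zero => simp
      | add s s' hs hs' => simp only [map_add, LinearMap.add_apply, hs, hs', add_mul]
      | tmul p q => simp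
  have hR : ∀ t : A ⊗[k] H, ρ.twistedMul hB (a ⊗ₜ b)
      (((LinearMap.mul k B).flip f).lTensor A (hB.slide t (c ⊗ₜ d))) =
      Q (ρ.coact c) (TensorProduct.assoc k A H H (ρ.coact.rTensor H t)) := by
    intro t
    induction t with
    | zero => simp
    | add s s' hs hs' => simp only [map_add, LinearMap.add_apply, hs, hs']
    | tmul e' n =>
      simp only [HAlgebra.slide, map₂_apply_tmul, map_tmul, LinearMap.lTensor_tmul,
        LinearMap.rTensor_tmul, LinearMap.flip_apply, LinearMap.mul_apply', twistedMul_tmul_tmul,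
        ρ.coact_mul]
      generalize ρ.coact c = s
      generalize ρ.coact e' = t
      induction s with
      | zero => simp
      | add s s' hs hs' => simp only [map_add, LinearMap.add_apply, hs, hs']
      | tmul c' m =>
      induction t with
      | zero => simp
      | add s s' hs hs' => simp only [map_add, add_tmul, hs, hs']
      | tmul e'' n' => simp [Q, mul_assoc]
  have hc := congrArg (Q (ρ.coact c)) (LinearMap.congr_fun ρ.coassoc e)
  simp only [LinearMap.comp_apply, LinearEquiv.coe_coe] at hc
  rw [twistedMul_tmul, twistedMul_tmul, twistedMul_tmul, hL, hR, hc]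

/-- The vector space `A ⊗ B`, to be endowed with the twisted multiplication. -/
def YetterDrinfeld.Twisted (_ρ : YetterDrinfeld hA) (_hB : HAlgebra k H B) : Type _ := A ⊗[k] B

instance (ρ : YetterDrinfeld hA) (hB : HAlgebra k H B) : AddCommGroup (ρ.Twisted hB) :=
  inferInstanceAs (AddCommGroup (A ⊗[k] B))

instance (ρ : YetterDrinfeld hA) (hB : HAlgebra k H B) : Module k (ρ.Twisted hB) :=
  inferInstanceAs (Module k (A ⊗[k] B))

/-- The element `a ⊗ b` of the twisted tensor product. -/
def YetterDrinfeld.tw (ρ : YetterDrinfeld hA) (hB : HAlgebra k H B) (a : A) (b : B) :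
    ρ.Twisted hB := a ⊗ₜ[k] b

instance (ρ : YetterDrinfeld hA) (hB : HAlgebra k H B) : Ring (ρ.Twisted hB) where
  __ := (inferInstance : AddCommGroup (ρ.Twisted hB))
  mul x y := ρ.twistedMul hB x y
  one := ρ.tw hB 1 1
  mul_assoc := ρ.twistedMul_assoc hB
  one_mul := ρ.one_twistedMul hB
  mul_one := ρ.twistedMul_one hB
  zero_mul x := LinearMap.congr_fun (map_zero (ρ.twistedMul hB)) x
  mul_zero x := map_zero (ρ.twistedMul hB x)
  left_distrib x y z := map_add (ρ.twistedMul hB x) y z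
  right_distrib x y z := LinearMap.congr_fun (map_add (ρ.twistedMul hB) x y) z
instance (ρ : YetterDrinfeld hA) (hB : HAlgebra k H B) : Algebra k (ρ.Twisted hB) :=
  Algebra.ofModule
    (fun c x y => LinearMap.congr_fun (map_smul (ρ.twistedMul hB) c x) y)
    (fun c x y => map_smul (ρ.twistedMul hB x) c y)

/-- The diagonal action `h · (a ⊗ b) = h⁽⁰⁾ · a ⊗ h⁽¹⁾ · b`. -/
def HAlgebra.diag (hA : HAlgebra k H A) (hB : HAlgebra k H B) :
    H →ₐ[k] Module.End k (A ⊗[k] B) :=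
  ((Module.endTensorEndAlgHom (R := k) (S := k) (A := k) (M := A) (N := B)).comp
    (Algebra.TensorProduct.map hA.act hB.act)).comp (Bialgebra.comulAlgHom k H)

theorem HAlgebra.diag_apply (hA : HAlgebra k H A) (hB : HAlgebra k H B) (h : H) (w : A ⊗[k] B) :
    hA.diag hB h w = map₂ hA.act.toLinearMap hB.act.toLinearMap (comul (R := k) h) w := by
  simp only [HAlgebra.diag, AlgHom.comp_apply, Bialgebra.comulAlgHom_apply]
  generalize comul (R := k) h = t
  induction t with
  | zero => simp
  | add s s' hs hs' => simp only [map_add, LinearMap.add_apply, hs, hs']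
  | tmul x y => rfl

theorem YetterDrinfeld.diag_twistedMul (ρ : YetterDrinfeld hA) (hB : HAlgebra k H B)
    (h : H) (x y : A ⊗[k] B) : hA.diag hB h (ρ.twistedMul hB x y) =
      ∑ i ∈ (ℛ k h).index, ρ.twistedMul hB (hA.diag hB ((ℛ k h).left i) x)
        (hA.diag hB ((ℛ k h).right i) y) := by
  -- compatibility with right multiplication by `1 ⊗ d`
  have step1 : ∀ (h : H) (d : B) (w : A ⊗[k] B),
      hA.diag hB h (((LinearMap.mul k B).flip d).lTensor A w) = ∑ i ∈ (ℛ k h).index,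
        ((LinearMap.mul k B).flip (hB.act ((ℛ k h).right i) d)).lTensor A
          (hA.diag hB ((ℛ k h).left i) w) := by
    intro h d w
    induction w with
    | zero => simp
    | add s s' hs hs' => simp only [map_add, hs, hs', Finset.sum_add_distrib]
    | tmul a b =>
    have := sum_coassoc (k := k) (LinearMap.mk₂ k (fun p q : H =>
        TensorProduct.mk k A B (hA.act p a) ∘ₗ LinearMap.mulLeft k (hB.act q b) ∘ₗ
          hB.act.toLinearMap.flip d)
        (by intros; ext; simp ) (by intros; ext; simp [smul_tmul'])
        (by intros; ext; simp [add_mul, tmul_add]) (by intros; ext; simp)) h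
    simp only [LinearMap.mk₂_apply, LinearMap.comp_apply, LinearMap.mulLeft_apply,
      LinearMap.flip_apply, AlgHom.toLinearMap_apply, TensorProduct.mk_apply] at this
    simp only [HAlgebra.diag_apply, comul_sum, map_sum, LinearMap.sum_apply, map₂_apply_tmul,
      LinearMap.lTensor_tmul, AlgHom.toLinearMap_apply, LinearMap.flip_apply,
      LinearMap.mul_apply', hB.act_mul, map_tmul, LinearMap.mul'_apply, tmul_sum]
    exact this.symm
  -- compatibility with the operators `slide (ρ c)`
  have step2 : ∀ (h : H) (c : A) (w : A ⊗[k] B),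
      hA.diag hB h (hB.slide (ρ.coact c) w) = ∑ i ∈ (ℛ k h).index,
        hB.slide (ρ.coact (hA.act ((ℛ k h).right i) c)) (hA.diag hB ((ℛ k h).left i) w) := by
    intro h c w
    induction w with
    | zero => simp
    | add s s' hs hs' => simp only [map_add, hs, hs', Finset.sum_add_distrib]
    | tmul a b =>
    have e1 : ∀ t : A ⊗[k] H, hA.diag hB h (hB.slide t (a ⊗ₜ b)) = ∑ i ∈ (ℛ k h).index,
        hB.slide (map₂ hA.act.toLinearMap (LinearMap.mul k H)
          (comul (R := k) ((ℛ k h).right i)) t) (hA.act ((ℛ k h).left i) a ⊗ₜ b) := by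
      intro t
      induction t with
      | zero => simp
      | add s s' hs hs' => simp only [map_add, LinearMap.add_apply, hs, hs',
          Finset.sum_add_distrib]
      | tmul c' m =>
      have := sum_coassoc (k := k) (LinearMap.mk₂ k (fun p q : H =>
          TensorProduct.mk k A B (hA.act p a * hA.act q c') ∘ₗ
            hB.act.toLinearMap.flip (hB.act m b))
          (by intros; ext; simp [add_mul]) (by intros; ext; simp [smul_tmul'])
          (by intros; ext; simp [mul_add]) (by intros; ext; simp [smul_tmul'])) h
      simp only [LinearMap.mk₂_apply, LinearMap.comp_apply,
        LinearMap.flip_apply, AlgHom.toLinearMap_apply, TensorProduct.mk_apply] at this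
      simp only [HAlgebra.diag_apply, HAlgebra.slide, comul_sum, map_sum, LinearMap.sum_apply,
        map₂_apply_tmul, AlgHom.toLinearMap_apply, LinearMap.flip_apply, map_mul,
        Module.End.mul_apply, LinearMap.mul_apply', hA.act_mul, map_tmul, LinearMap.mul'_apply,
        sum_tmul]
      exact this
    have e2 : ∀ (p : H) (t : A ⊗[k] H) (a' : A),
        hB.slide (((LinearMap.mul k H).flip p).lTensor A t) (a' ⊗ₜ b) =
          hB.slide t (a' ⊗ₜ hB.act p b) := by
      intro p t a'
      induction t with
      | zero => simp
      | add s s' hs hs' => simp only [map_add, LinearMap.add_apply, hs, hs']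
      | tmul c' m => simp [HAlgebra.slide]
    rw [e1]
    simp only [← ρ.yetterDrinfeld]
    simp only [comul_sum, map_sum, lift.tmul, LinearMap.mk₂_apply, map_tmul,
      LinearMap.sum_apply, e2, HAlgebra.diag_apply, map₂_apply_tmul, AlgHom.toLinearMap_apply]
    have := sum_coassoc (k := k) (LinearMap.mk₂ k (fun p q : H =>
          hB.slide.flip (hA.act p a ⊗ₜ hB.act q b) ∘ₗ ρ.coact ∘ₗ hA.act.toLinearMap.flip c)
          (by intros; ext; simp [add_tmul]) (by intros; ext; simp [← smul_tmul'])
          (by intros; ext; simp [tmul_add]) (by intros; ext; simp)) h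
    simp only [LinearMap.mk₂_apply, LinearMap.comp_apply,
        LinearMap.flip_apply, AlgHom.toLinearMap_apply] at this
    exact this.symm
  induction y with
  | zero => simp
  | add s s' hs hs' => simp only [map_add, hs, hs', Finset.sum_add_distrib]
  | tmul c d =>
  have := sum_coassoc (k := k) (LinearMap.mk₂ k (fun p q : H =>
      (ρ.twistedMul hB).flip.compl₁₂ (TensorProduct.mk k A B (hA.act q c) ∘ₗ
        hB.act.toLinearMap.flip d) .id |>.flip (hA.diag hB p x))
      (by intros; ext; simp) (by intros; ext; simp)
      (by intros; ext; simp) (by intros; ext; simp)) h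
  simp only [LinearMap.mk₂_apply, LinearMap.compl₁₂_apply, LinearMap.comp_apply,
    LinearMap.id_apply,
    LinearMap.flip_apply, AlgHom.toLinearMap_apply, TensorProduct.mk_apply] at this
  rw [twistedMul_tmul, step1]
  refine Eq.trans ?_ (this.trans ?_)
  · refine Finset.sum_congr rfl fun i _ => ?_
    rw [step2, map_sum]
    refine Finset.sum_congr rfl fun j _ => ?_
    rw [twistedMul_tmul]
  · refine Finset.sum_congr rfl fun i _ => ?_
    rw [← map_sum]
    congr 1
    rw [HAlgebra.diag_apply, comul_sum]
    simp only [map_sum, LinearMap.sum_apply, map₂_apply_tmul, map_tmul, AlgHom.toLinearMap_apply]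

/-- The twisted tensor product of a Yetter-Drinfeld algebra `A` with an `H`-algebra `B`, as an
`H`-algebra with the diagonal action. -/
def YetterDrinfeld.twisted (ρ : YetterDrinfeld hA) (hB : HAlgebra k H B) :
    HAlgebra k H (ρ.Twisted hB) where
  act := hA.diag hB
  act_one h := by
    change hA.diag hB h (1 ⊗ₜ 1) = counit (R := k) h • (1 ⊗ₜ[k] 1)
    have : ∀ t : H ⊗[k] H,
        map₂ hA.act.toLinearMap hB.act.toLinearMap t (1 ⊗ₜ[k] 1) =
        (LinearMap.mul' k k (map (counit (R := k)) (counit (R := k)) t)) • (1 ⊗ₜ[k] 1) := by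
      intro t
      induction t with
      | zero => simp
      | add s s' hs hs' => simp only [map_add, LinearMap.add_apply, hs, hs', add_smul]
      | tmul x y => simp [hA.act_one, hB.act_one, smul_tmul', smul_smul, mul_comm]
    rw [HAlgebra.diag_apply, this]
    congr 1
    simpa [comul_sum] using congrArg (counit (R := k)) (sum_counit_smul (ℛ k h))
  act_mul h x y := by
    refine (ρ.diag_twistedMul hB h x y).trans ?_
    rw [comul_sum]
    simp only [map_sum, LinearMap.sum_apply, map₂_apply_tmul]
    rfl
end YD

section Cohomology

variable {k : Type*} [Field k] {H : Type*} [Ring H] [HopfAlgebra k H]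
variable {A : Type*} [Ring A] [Algebra k A]

variable (k H A) in
/-- `Cⁿ(A, F(H))`: the `(n+1)`-linear maps from `A` to the space `F(H)` of linear functionals
on `H`. -/
abbrev Cochain (n : ℕ) : Type _ := MultilinearMap k (fun _ : Fin (n + 1) => A) (H →ₗ[k] k)

instance (n : ℕ) : AddCommGroup (Cochain k H A n) := MultilinearMap.instAddCommGroup

variable (k H) in
/-- `sweedler n Φ h = Φ(h⁽⁰⁾, …, h⁽ⁿ⁾)`, for an `(n+1)`-linear map `Φ` on `H`. -/
def sweedler {M : Type*} [AddCommGroup M] [Module k M] : (n : ℕ) →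
    MultilinearMap k (fun _ : Fin (n + 1) => H) M →ₗ[k] H →ₗ[k] M
  | 0 => (MultilinearMap.ofSubsingletonₗ k k H M (0 : Fin 1)).symm.toLinearMap
  | n + 1 =>
    { toFun := fun Φ => lift (sweedler n ∘ₗ Φ.curryLeft) ∘ₗ comul
      map_add' := by
        intro Φ Ψ
        rw [← LinearMap.add_comp]
        congr 1
        ext x y
        exact LinearMap.congr_fun (map_add (sweedler n) (Φ.curryLeft x) (Ψ.curryLeft x)) y
      map_smul' := by
        intro c Φ
        rw [RingHom.id_apply, ← LinearMap.smul_comp]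
        congr 1
        ext x y
        exact LinearMap.congr_fun (map_smul (sweedler n) c (Φ.curryLeft x)) y }

/-- `S⁻¹(h) · g = S(h⁽¹⁾) g h⁽⁰⁾`. -/
def rightTwist (g : H) : H →ₗ[k] H :=
  lift (LinearMap.mk₂ k (fun x y : H => antipode k y * g * x)
    (by intros; simp [mul_add]) (by intros; simp)
    (by intros; simp [add_mul]) (by intros; simp)) ∘ₗ comul

/-- The space `C_Hⁿ(A)` of `H`-equivariant cochains:
`f(h⁽⁰⁾ · a₀, …, h⁽ⁿ⁾ · aₙ)(g) = f(a₀, …, aₙ)(S(h⁽¹⁾) g h⁽⁰⁾)`. -/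
def equivariantCochains (hA : HAlgebra k H A) (n : ℕ) : Submodule k (Cochain k H A n) where
  carrier := {f | ∀ (h g : H) (a : Fin (n + 1) → A),
    sweedler k H n (f.compLinearMap fun i => hA.act.toLinearMap.flip (a i)) h g =
      f a (rightTwist (k := k) g h)}
  add_mem' {f f'} hf hf' h g a := by
    have := congr($(hf h g a) + $(hf' h g a))
    rw [_root_.add_apply, LinearMap.add_apply, ← this, ← LinearMap.add_apply,
      ← LinearMap.add_apply, ← map_add]
    rfl
  zero_mem' h g a := by
    change (sweedler k H n (0 : MultilinearMap k (fun _ : Fin (n + 1) => H) (H →ₗ[k] k)) h :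
      H →ₗ[k] k) g = 0
    simp
  smul_mem' c f hf h g a := by
    have := congr(c • $(hf h g a))
    rw [_root_.smul_apply, LinearMap.smul_apply, ← this, ← LinearMap.smul_apply,
      ← LinearMap.smul_apply, ← map_smul]
    rfl

/-- The inverse of a bijective antipode. -/
def antipodeInv (hS : Function.Bijective (antipode k : H →ₗ[k] H)) : H →ₗ[k] H :=
  (LinearEquiv.ofBijective (antipode k : H →ₗ[k] H) hS).symm.toLinearMap

theorem lift_add (Φ Ψ : H →ₗ[k] H →ₗ[k] k) : lift (Φ + Ψ) = lift Φ + lift Ψ :=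
  TensorProduct.ext' fun x y => by simp

theorem lift_smul (c : k) (Φ : H →ₗ[k] H →ₗ[k] k) : lift (c • Φ) = c • lift Φ :=
  TensorProduct.ext' fun x y => by simp

/-- The bilinear map `(x, y) ↦ f(S⁻¹(x) · aₙ, a₀, …, aₙ₋₁)(y)`. -/
def cyclicAux (hS : Function.Bijective (antipode k : H →ₗ[k] H)) (hA : HAlgebra k H A) {n : ℕ}
    (f : Cochain k H A n) (a : Fin (n + 1) → A) : H →ₗ[k] H →ₗ[k] k :=
  LinearMap.mk₂ k
    (fun x y : H => f (Fin.cons (hA.act (antipodeInv hS x) (a (Fin.last n))) (Fin.init a)) y)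
    (by intros; simp only [map_add, LinearMap.add_apply, f.cons_add])
    (by intros; simp only [map_smul, LinearMap.smul_apply, f.cons_smul])
    (by intros; simp) (by intros; simp)

/-- The cyclic operator
`(T f)(a₀, …, aₙ)(g) = f(S⁻¹(g⁽⁰⁾) · aₙ, a₀, …, aₙ₋₁)(g⁽¹⁾)`. -/
def cyclicOp (hS : Function.Bijective (antipode k : H →ₗ[k] H)) (hA : HAlgebra k H A) (n : ℕ) :
    Cochain k H A n →ₗ[k] Cochain k H A n where
  toFun f :=
    { toFun := fun a => lift (cyclicAux hS hA f a) ∘ₗ comul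
      map_update_add' := by
        intro inst a m x y
        obtain rfl : inst = instDecidableEqFin _ := Subsingleton.elim _ _
        rw [← LinearMap.add_comp, ← lift_add]
        congr 2
        ext p q
        induction m using Fin.lastCases with
        | last => simpa [cyclicAux] using LinearMap.congr_fun (f.cons_add (Fin.init a) _ _) q
        | cast j =>
          simp only [cyclicAux, LinearMap.mk₂_apply, Fin.init_update_castSucc, Fin.cons_update,
            MultilinearMap.map_update_add, LinearMap.add_apply, ne_eq,
            (Fin.castSucc_lt_last j).ne', not_false_eq_true, Function.update_of_ne]
      map_update_smul' := by
        intro inst a m c x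
        obtain rfl : inst = instDecidableEqFin _ := Subsingleton.elim _ _
        rw [← LinearMap.smul_comp, ← lift_smul]
        congr 2
        ext p q
        induction m using Fin.lastCases with
        | last => simpa [cyclicAux] using LinearMap.congr_fun (f.cons_smul (Fin.init a) c _) q
        | cast j =>
          simp only [cyclicAux, LinearMap.mk₂_apply, Fin.init_update_castSucc, Fin.cons_update,
            MultilinearMap.map_update_smul, LinearMap.smul_apply, ne_eq,
            (Fin.castSucc_lt_last j).ne', not_false_eq_true, Function.update_of_ne] }
  map_add' f f' := by
    have h : ∀ a, cyclicAux hS hA (f + f') a = cyclicAux hS hA f a + cyclicAux hS hA f' a :=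
      fun a => by ext p q; rfl
    refine MultilinearMap.ext fun a => ?_
    change lift (cyclicAux hS hA (f + f') a) ∘ₗ comul =
      lift (cyclicAux hS hA f a) ∘ₗ comul + lift (cyclicAux hS hA f' a) ∘ₗ comul
    rw [h, lift_add, LinearMap.add_comp]
  map_smul' c f := by
    have h : ∀ a, cyclicAux hS hA (c • f) a = c • cyclicAux hS hA f a :=
      fun a => by ext p q; rfl
    refine MultilinearMap.ext fun a => ?_
    change lift (cyclicAux hS hA (c • f) a) ∘ₗ comul = c • (lift (cyclicAux hS hA f a) ∘ₗ comul)
    rw [h, lift_smul, LinearMap.smul_comp]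

theorem exists_contractNth_update {n : ℕ} (i : Fin (n + 1)) [DecidableEq (Fin (n + 2))]
    (a : Fin (n + 2) → A) (m : Fin (n + 2)) :
    ∃ (m' : Fin (n + 1)) (φ : A →ₗ[k] A), ∀ x,
      Fin.contractNth i.castSucc (· * ·) (Function.update a m x) =
        Function.update (Fin.contractNth i.castSucc (· * ·) a) m' (φ x) := by
  refine ⟨i.predAbove m, if m = i.castSucc then LinearMap.mulRight k (a i.succ) else
    if m = i.succ then LinearMap.mulLeft k (a i.castSucc) else LinearMap.id, fun x => ?_⟩
  have hs : ∀ (p q : Fin (n + 2)) , Function.update a p x q = if (q : ℕ) = p then x else a q := by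
    intro p q
    simp [Function.update_apply, Fin.ext_iff]
  have hs' : ∀ (c : Fin (n + 1) → A) (p q : Fin (n + 1)) (z : A),
      Function.update c p z q = if (q : ℕ) = p then z else c q := by
    intro c p q z
    simp [Function.update_apply, Fin.ext_iff]
  have hp : (i.predAbove m : ℕ) = if (i : ℕ) < m then (m : ℕ) - 1 else m := by
    simp only [Fin.predAbove, Fin.lt_def, Fin.val_castSucc]
    split_ifs <;> simp_all
  ext j
  rw [hs']
  simp only [Fin.contractNth, hs, hp, Fin.ext_iff, Fin.val_castSucc, Fin.val_succ]
  have e1 : (j : ℕ) = i → j = i := Fin.ext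
  have e2 : (j : ℕ) + 1 = m → j.succ = m := fun h => Fin.ext h
  have e3 : (j : ℕ) = m → j.castSucc = m := fun h => Fin.ext h
  split_ifs <;> first | omega | rfl | skip
  all_goals (obtain rfl := e1 ‹_›; rfl)

/-- The coface operators `(∂ⁱ f)(a₀, …, aₙ₊₁) = f(a₀, …, aᵢ aᵢ₊₁, …, aₙ₊₁)`, `0 ≤ i ≤ n`. -/
def coface (n : ℕ) (i : Fin (n + 1)) : Cochain k H A n →ₗ[k] Cochain k H A (n + 1) where
  toFun f :=
    { toFun := fun a => f (Fin.contractNth i.castSucc (· * ·) a)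
      map_update_add' := by
        intro _ a m x y
        obtain ⟨m', φ, h⟩ := exists_contractNth_update (k := k) i a m
        simp only [h, map_add, f.map_update_add]
      map_update_smul' := by
        intro _ a m c x
        obtain ⟨m', φ, h⟩ := exists_contractNth_update (k := k) i a m
        simp only [h, map_smul, f.map_update_smul] }
  map_add' _ _ := rfl
  map_smul' _ _ := rfl

/-- The last coface operator
`(∂ⁿ⁺¹ f)(a₀, …, aₙ₊₁)(g) = f((S⁻¹(g⁽⁰⁾) · aₙ₊₁) a₀, a₁, …, aₙ)(g⁽¹⁾)`. -/
def lastCoface (hS : Function.Bijective (antipode k : H →ₗ[k] H)) (hA : HAlgebra k H A) (n : ℕ) :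
    Cochain k H A n →ₗ[k] Cochain k H A (n + 1) :=
  cyclicOp hS hA (n + 1) ∘ₗ coface n 0

/-- The Hochschild coboundary `b = ∑ (-1)ⁱ ∂ⁱ`, summed over `0 ≤ i ≤ n + 1`. -/
def coboundary (hS : Function.Bijective (antipode k : H →ₗ[k] H)) (hA : HAlgebra k H A) (n : ℕ) :
    Cochain k H A n →ₗ[k] Cochain k H A (n + 1) :=
  ∑ i : Fin (n + 1), (-1 : k) ^ (i : ℕ) • coface n i + (-1 : k) ^ (n + 1) • lastCoface hS hA n

/-- The equivariant cyclic cochains: `f ∈ C_Hⁿ(A)` with `T f = (-1)ⁿ f`. -/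
def cyclicCochains (hS : Function.Bijective (antipode k : H →ₗ[k] H)) (hA : HAlgebra k H A)
    (n : ℕ) : Submodule k (Cochain k H A n) :=
  equivariantCochains hA n ⊓
    LinearMap.eqLocus (cyclicOp hS hA n) ((-1 : k) ^ n • LinearMap.id)

/-- The equivariant cyclic cocycles. -/
def cyclicCocycles (hS : Function.Bijective (antipode k : H →ₗ[k] H)) (hA : HAlgebra k H A)
    (n : ℕ) : Submodule k (Cochain k H A n) :=
  cyclicCochains hS hA n ⊓ LinearMap.ker (coboundary hS hA n)

/-- The equivariant cyclic coboundaries: `b(C_λⁿ⁻¹)`, and `0` in degree `0`. -/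
def cyclicCoboundaries (hS : Function.Bijective (antipode k : H →ₗ[k] H))
    (hA : HAlgebra k H A) : (n : ℕ) → Submodule k (Cochain k H A n)
  | 0 => ⊥
  | n + 1 => (cyclicCochains hS hA n).map (coboundary hS hA n)

/-- The equivariant cyclic cohomology `HC_Hⁿ(A)`: the `n`-th cohomology of the complex of
equivariant cyclic cochains. -/
abbrev HC (hS : Function.Bijective (antipode k : H →ₗ[k] H)) (hA : HAlgebra k H A) (n : ℕ) :
    Type _ :=
  cyclicCocycles hS hA n ⧸ (cyclicCoboundaries hS hA n).submoduleOf (cyclicCocycles hS hA n)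

/-- The class of a cyclic cocycle. -/
def HC.mk (hS : Function.Bijective (antipode k : H →ₗ[k] H)) (hA : HAlgebra k H A) (n : ℕ) :
    cyclicCocycles hS hA n →ₗ[k] HC hS hA n :=
  Submodule.mkQ _

end Cohomology

end EquivariantCyclic

end

open EquivariantCyclic

noncomputable section

namespace EquivariantCyclic

open TensorProduct Coalgebra HopfAlgebra

/-! ### Maps of cocyclic modules and the maps they induce on cohomology. -/

section CocyclicMaps

variable {k : Type*} [Field k] {H : Type*} [Ring H] [HopfAlgebra k H]
variable {A : Type*} [Ring A] [Algebra k A] {B : Type*} [Ring B] [Algebra k B]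
variable {C : Type*} [Ring C] [Algebra k C]
variable {hS : Function.Bijective (antipode k : H →ₗ[k] H)}
variable {hA : HAlgebra k H A} {hB : HAlgebra k H B} {hC : HAlgebra k H C} {n : ℕ}

/-! Write `E = End V`, with matrix units `m p q`, and let `e = m p p` be a rank one idempotent.
Since `V` is trivial, so is the action on `E`. The twisted product and the diagonal action on `A ⊗
E` therefore coincide with the untwisted ones, and the first claim reduces to the second.

In the untwisted case the inverse of the trace map is restriction of cochains along the non-unital
homomorphism `a ↦ a ⊗ e`. One composite is the identity already on cochains, because `tr e = 1`. For
the other composite, a cocycle `f` on `A ⊗ E` is extended by the trace to a cocycle `F` on `(A ⊗ E)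
⊗ E`. Restricting `F` along `x ↦ x ⊗ e` returns `f`. If `F` is first pulled back along the flip of
the two copies of `E`, the same restriction gives the composite applied to `f`. The flip is
conjugation by the invariant involution `w = ∑ m p q ⊗ m q p`, so it suffices that such a
conjugation acts trivially on cohomology (`pullback_conj_sub_mem_cyclicCoboundaries`, used in
`IsMatrixUnits.traceMap_inclPullback_sub_mem`).

For that, put `P = (1 - w) / 2`, an invariant idempotent. A Cartan formula (`sum_lie_eq_neg_faces`,
`lieDeriv_mem_cyclicCoboundaries`) shows that the derivation `[P, ·]` sends a cyclic cocycle `f` to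
the coboundary of `-ι_P f`, where `ι_P` inserts `P` with alternating signs. The Peirce decomposition
for `P` splits `f` into weight components. They are again cocycles, being the coefficients of a
Laurent polynomial in `t` whose values are the pullbacks of `f` along conjugation by `t P + (1 -
P)`. In characteristic zero every component of nonzero weight is then a coboundary. Conjugation by
`w` is the case `t = -1`; it fixes the component of weight zero, so it changes `f` by a coboundary.
-/

theorem cyclicOp_apply (f : Cochain k H A n) (a : Fin (n + 1) → A) (g : H) :
    cyclicOp hS hA n f a g = ∑ i ∈ (ℛ k g).index,
      f (Fin.cons (hA.act (antipodeInv hS ((ℛ k g).left i)) (a (Fin.last n))) (Fin.init a))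
        ((ℛ k g).right i) := by
  change lift (cyclicAux hS hA f a) (comul (R := k) g) = _
  simp only [comul_sum, map_sum, lift.tmul]
  rfl

theorem coface_apply (i : Fin (n + 1)) (f : Cochain k H A n) (a : Fin (n + 2) → A) :
    coface n i f a = f (Fin.contractNth i.castSucc (· * ·) a) := rfl

theorem coboundary_apply (f : Cochain k H A n) :
    coboundary hS hA n f = ∑ i : Fin (n + 1), (-1 : k) ^ (i : ℕ) • coface n i f +
      (-1 : k) ^ (n + 1) • cyclicOp hS hA (n + 1) (coface n 0 f) := by
  simp [coboundary, lastCoface, LinearMap.sum_apply]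

variable (hS hA hB) in
/-- A map of cocyclic modules, defined on all cochains and preserving equivariance. -/
structure CocyclicHom where
  /-- The underlying maps of cochains. -/
  app : ∀ n : ℕ, Cochain k H A n →ₗ[k] Cochain k H B n
  map_equivariant : ∀ {n : ℕ} {f : Cochain k H A n}, f ∈ equivariantCochains hA n →
    app n f ∈ equivariantCochains hB n
  app_cyclicOp : ∀ (n : ℕ) (f : Cochain k H A n),
    app n (cyclicOp hS hA n f) = cyclicOp hS hB n (app n f)
  app_coface : ∀ (n : ℕ) (i : Fin (n + 1)) (f : Cochain k H A n),
    app (n + 1) (coface n i f) = coface n i (app n f)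

namespace CocyclicHom

variable (Φ : CocyclicHom hS hA hB)

theorem app_coboundary (f : Cochain k H A n) :
    Φ.app (n + 1) (coboundary hS hA n f) = coboundary hS hB n (Φ.app n f) := by
  simp only [coboundary_apply, map_add, map_sum, map_smul, Φ.app_coface, Φ.app_cyclicOp]

theorem map_cyclicCochains {f : Cochain k H A n} (hf : f ∈ cyclicCochains hS hA n) :
    Φ.app n f ∈ cyclicCochains hS hB n :=
  ⟨Φ.map_equivariant hf.1, ((Φ.app_cyclicOp n f).symm.trans (congrArg _ hf.2)).trans
    (map_smul (Φ.app n) ((-1 : k) ^ n) f)⟩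

theorem map_cyclicCocycles {f : Cochain k H A n} (hf : f ∈ cyclicCocycles hS hA n) :
    Φ.app n f ∈ cyclicCocycles hS hB n :=
  ⟨Φ.map_cyclicCochains hf.1, ((Φ.app_coboundary f).symm.trans (congrArg _ hf.2)).trans
    (map_zero _)⟩

theorem map_cyclicCoboundaries {f : Cochain k H A n} (hf : f ∈ cyclicCoboundaries hS hA n) :
    Φ.app n f ∈ cyclicCoboundaries hS hB n := by
  cases n with
  | zero =>
    obtain rfl : f = 0 := hf
    exact (map_zero (Φ.app 0) : _)
  | succ n =>
    obtain ⟨z, hz, rfl⟩ := hf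
    exact ⟨Φ.app n z, Φ.map_cyclicCochains hz, (Φ.app_coboundary z).symm⟩

/-- The composition of maps of cocyclic modules. -/
def comp (Ψ : CocyclicHom hS hB hC) (Φ : CocyclicHom hS hA hB) : CocyclicHom hS hA hC where
  app n := Ψ.app n ∘ₗ Φ.app n
  map_equivariant hf := Ψ.map_equivariant (Φ.map_equivariant hf)
  app_cyclicOp n f := by simp only [LinearMap.comp_apply, Φ.app_cyclicOp, Ψ.app_cyclicOp]
  app_coface n i f := by simp only [LinearMap.comp_apply, Φ.app_coface, Ψ.app_coface]

variable (n) in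
/-- The restriction to cyclic cocycles. -/
def onCocycles : cyclicCocycles hS hA n →ₗ[k] cyclicCocycles hS hB n :=
  (Φ.app n).restrict fun _ => Φ.map_cyclicCocycles

variable (n) in
/-- The map induced on equivariant cyclic cohomology. -/
def onHC : HC hS hA n →ₗ[k] HC hS hB n :=
  Submodule.mapQ _ _ (Φ.onCocycles n) fun _ hf => Φ.map_cyclicCoboundaries hf

theorem onHC_mk (f : cyclicCocycles hS hA n) :
    Φ.onHC n (HC.mk hS hA n f) = HC.mk hS hB n (Φ.onCocycles n f) := rfl

theorem HC_mk_eq {f f' : cyclicCocycles hS hA n}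
    (h : (f : Cochain k H A n) - f' ∈ cyclicCoboundaries hS hA n) :
    HC.mk hS hA n f = HC.mk hS hA n f' :=
  (Submodule.Quotient.eq _).2 h

/-- Maps of cocyclic modules which are mutually inverse up to coboundaries induce an isomorphism
of the equivariant cyclic cohomologies. -/
def equivHC (Ψ : CocyclicHom hS hB hA)
    (h₁ : ∀ f ∈ cyclicCocycles hS hA n, Ψ.app n (Φ.app n f) - f ∈ cyclicCoboundaries hS hA n)
    (h₂ : ∀ f ∈ cyclicCocycles hS hB n, Φ.app n (Ψ.app n f) - f ∈ cyclicCoboundaries hS hB n) :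
    HC hS hA n ≃ₗ[k] HC hS hB n :=
  LinearEquiv.ofLinearMap (Φ.onHC n) (Ψ.onHC n)
    (Submodule.linearMap_qext _ (LinearMap.ext fun f => HC_mk_eq (h₂ f.1 f.2)))
    (Submodule.linearMap_qext _ (LinearMap.ext fun f => HC_mk_eq (h₁ f.1 f.2)))

end CocyclicHom

variable (hA hB) in
/-- `H`-equivariance of a linear map. -/
def HAlgebra.Intertwines (φ : A →ₗ[k] B) : Prop :=
  ∀ (h : H) (a : A), φ (hA.act h a) = hB.act h (φ a)

theorem compLinearMap_mem_equivariantCochains {f : Cochain k H B n}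
    (hf : f ∈ equivariantCochains hB n) {φ : Fin (n + 1) → A →ₗ[k] B}
    (hφ : ∀ i, hA.Intertwines hB (φ i)) : f.compLinearMap φ ∈ equivariantCochains hA n := by
  intro h g a
  refine Eq.trans ?_ (hf h g fun i => φ i (a i))
  congr 3
  ext x : 1
  exact congrArg f (funext fun i => hφ i (x i) (a i))

theorem comp_contractNth {X Y : Type*} [Mul X] [Mul Y] (φ : X → Y)
    (hφ : ∀ x y, φ (x * y) = φ x * φ y) (i : Fin (n + 1)) (a : Fin (n + 1) → X) :
    φ ∘ Fin.contractNth i (· * ·) a = Fin.contractNth i (· * ·) (φ ∘ a) := by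
  ext j
  simp only [Fin.contractNth, Function.comp_apply]
  split_ifs <;> simp [hφ]

/-- The pullback of cochains along an equivariant homomorphism, not necessarily unital. -/
def pullback (φ : A →ₙₐ[k] B) (hφ : hA.Intertwines hB (φ : A →ₗ[k] B)) :
    CocyclicHom hS hB hA where
  app n := MultilinearMap.compLinearMapₗ fun _ : Fin (n + 1) => (φ : A →ₗ[k] B)
  map_equivariant hf := compLinearMap_mem_equivariantCochains hf fun _ => hφ
  app_cyclicOp n f := by
    ext a g
    simp only [MultilinearMap.compLinearMapₗ_apply, MultilinearMap.compLinearMap_apply,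
      cyclicOp_apply]
    refine Finset.sum_congr rfl fun i _ => ?_
    congr 2
    ext j
    cases j using Fin.cases with
    | zero => exact (hφ _ _).symm
    | succ j => rfl
  app_coface n i f := by
    ext a : 1
    exact congrArg f (comp_contractNth φ (map_mul φ) _ a).symm

theorem pullback_app_apply (φ : A →ₙₐ[k] B) (hφ : hA.Intertwines hB (φ : A →ₗ[k] B))
    (f : Cochain k H B n) (a : Fin (n + 1) → A) :
    (pullback (hS := hS) φ hφ).app n f a = f fun i => φ (a i) := rfl

end CocyclicMaps

/-! ### The trace map from cochains on `A` to cochains on `A ⊗ E`. -/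

section Trace

variable {k : Type*} [Field k] {H : Type*} [Ring H] [HopfAlgebra k H]
variable {A : Type*} [Ring A] [Algebra k A]
variable {E : Type*} [Ring E] [Algebra k E]
variable {hS : Function.Bijective (antipode k : H →ₗ[k] H)} {hA : HAlgebra k H A} {n : ℕ}

theorem HAlgebra.tensorRight_act_tmul (h : H) (a : A) (u : E) :
    (hA.tensorRight E).act h (a ⊗ₜ[k] u) = hA.act h a ⊗ₜ u := rfl

variable (A) in
/-- The linear map `a ⊗ u ↦ φ(u) a`. -/
def sliceRight (φ : E →ₗ[k] k) : A ⊗[k] E →ₗ[k] A :=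
  TensorProduct.rid k A ∘ₗ φ.lTensor A

theorem sliceRight_tmul (φ : E →ₗ[k] k) (a : A) (u : E) :
    sliceRight A φ (a ⊗ₜ u) = φ u • a := by
  simp [sliceRight]

theorem intertwines_sliceRight (φ : E →ₗ[k] k) :
    (hA.tensorRight E).Intertwines hA (sliceRight A φ) := by
  intro h w
  induction w with
  | zero => simp
  | add x y hx hy => simp only [map_add, hx, hy]
  | tmul a u => rw [HAlgebra.tensorRight_act_tmul, sliceRight_tmul, sliceRight_tmul, map_smul]

theorem eq_sum_sliceRight_tmul {κ : Type*} [Fintype κ] (b : Module.Basis κ k E) (w : A ⊗[k] E) :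
    w = ∑ e, sliceRight A (b.coord e) w ⊗ₜ b e := by
  induction w with
  | zero => simp
  | add x y hx hy =>
    simp only [map_add, add_tmul, Finset.sum_add_distrib]
    rw [← hx, ← hy]
  | tmul a u =>
    simp only [sliceRight_tmul, smul_tmul, ← tmul_sum, Module.Basis.coord_apply, b.sum_repr]

variable [Module.Finite k E]

theorem multilinear_ext_tmul {M : Type*} [AddCommGroup M] [Module k M] {ι : Type*} [Finite ι]
    {F F' : MultilinearMap k (fun _ : ι => A ⊗[k] E) M}
    (h : ∀ (a : ι → A) (u : ι → E), F (fun i => a i ⊗ₜ u i) = F' (fun i => a i ⊗ₜ u i)) :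
    F = F' := by
  classical
  have := Fintype.ofFinite ι
  ext w
  let b := Module.finBasis k E
  rw [funext fun i => eq_sum_sliceRight_tmul b (w i), F.map_sum, F'.map_sum]
  exact Finset.sum_congr rfl fun ε _ => h _ _

/-- The multilinear map `(a₀ ⊗ u₀, …, aₙ ⊗ uₙ) ↦ θ(u₀, …, uₙ) f(a₀, …, aₙ)`. -/
def cross (θ : MultilinearMap k (fun _ : Fin (n + 1) => E) k) :
    Cochain k H A n →ₗ[k] Cochain k H (A ⊗[k] E) n :=
  ∑ ε : Fin (n + 1) → Fin (Module.finrank k E),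
    θ (fun i => Module.finBasis k E (ε i)) • MultilinearMap.compLinearMapₗ
      fun i => sliceRight A ((Module.finBasis k E).coord (ε i))

theorem cross_tmul (θ : MultilinearMap k (fun _ : Fin (n + 1) => E) k) (f : Cochain k H A n)
    (a : Fin (n + 1) → A) (u : Fin (n + 1) → E) :
    cross θ f (fun i => a i ⊗ₜ u i) = θ u • f a := by
  conv_rhs => rw [← funext fun i => (Module.finBasis k E).sum_repr (u i), θ.map_sum,
    Finset.sum_smul]
  rw [cross, LinearMap.sum_apply, _root_.sum_apply]
  refine Finset.sum_congr rfl fun ε _ => ?_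
  rw [LinearMap.smul_apply, _root_.smul_apply, MultilinearMap.compLinearMapₗ_apply,
    MultilinearMap.compLinearMap_apply]
  simp only [sliceRight_tmul, MultilinearMap.map_smul_univ, Module.Basis.coord_apply, smul_smul,
    smul_eq_mul, mul_comm]

theorem cross_mem_equivariantCochains (θ : MultilinearMap k (fun _ : Fin (n + 1) => E) k)
    {f : Cochain k H A n} (hf : f ∈ equivariantCochains hA n) :
    cross θ f ∈ equivariantCochains (hA.tensorRight E) n := by
  rw [cross, LinearMap.sum_apply]
  exact Submodule.sum_mem _ fun ε _ => Submodule.smul_mem _ _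
    (compLinearMap_mem_equivariantCochains hf fun i => intertwines_sliceRight _)

theorem prod_ofFn_cons_init {M : Type*} [Monoid M] (x : M) (u : Fin (n + 1) → M) :
    (List.ofFn (Fin.cons x (Fin.init u) : Fin (n + 1) → M)).prod =
      x * (List.ofFn (Fin.init u)).prod := by
  rw [List.ofFn_succ, List.prod_cons]
  rfl

theorem prod_ofFn_contractNth {M : Type*} [Monoid M] (i : Fin (n + 1)) (u : Fin (n + 2) → M) :
    (List.ofFn (Fin.contractNth i.castSucc (· * ·) u)).prod = (List.ofFn u).prod := by
  -- The full product is the last partial product, and contraction only drops one of the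
  -- intermediate partial products.
  have key : ∀ {m : ℕ} (v : Fin m → M), (List.ofFn v).prod = Fin.partialProd v (Fin.last m) := by
    intro m v
    rw [Fin.partialProd, List.take_of_length_le (by simp)]
  rw [key, key, Fin.partialProd_contractNth, Function.comp_apply,
    Fin.succAbove_of_le_castSucc _ _ (by
      simp only [Fin.le_def, Fin.val_succ, Fin.val_castSucc, Fin.val_last]; omega),
    Fin.succ_last]

/-- The map `f ↦ ((a₀ ⊗ u₀, …, aₙ ⊗ uₙ) ↦ τ(u₀ ⋯ uₙ) f(a₀, …, aₙ))` of cocyclic modules defined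
by a trace `τ` on `E`. -/
def traceMap (τ : E →ₗ[k] k) (hτ : ∀ u v, τ (u * v) = τ (v * u)) :
    CocyclicHom hS hA (hA.tensorRight E) where
  app n := cross (τ.compMultilinearMap (MultilinearMap.mkPiAlgebraFin k (n + 1) E))
  map_equivariant := cross_mem_equivariantCochains _
  app_cyclicOp n f := by
    refine multilinear_ext_tmul fun a u => ?_
    ext g
    have e : ∀ x : H, (Fin.cons ((hA.tensorRight E).act x (a (Fin.last n) ⊗ₜ u (Fin.last n)))
        (Fin.init fun i => a i ⊗ₜ[k] u i) : Fin (n + 1) → A ⊗[k] E) = fun i =>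
        (Fin.cons (hA.act x (a (Fin.last n))) (Fin.init a) : Fin (n + 1) → A) i ⊗ₜ[k]
          (Fin.cons (u (Fin.last n)) (Fin.init u) : Fin (n + 1) → E) i := by
      intro x
      ext i
      cases i using Fin.cases <;> rfl
    rw [cross_tmul, LinearMap.smul_apply, cyclicOp_apply, cyclicOp_apply, Finset.smul_sum]
    refine Finset.sum_congr rfl fun i _ => ?_
    rw [e, cross_tmul, LinearMap.smul_apply]
    congr 1
    simp only [LinearMap.compMultilinearMap_apply, MultilinearMap.mkPiAlgebraFin_apply]
    -- The trace property moves the last factor to the front, matching the rotation performed by the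
    -- cyclic operator.
    rw [prod_ofFn_cons_init, hτ, List.ofFn_succ_last, List.prod_append, List.prod_singleton]
    rfl
  app_coface n i f := by
    refine multilinear_ext_tmul fun a u => ?_
    have e : Fin.contractNth i.castSucc (· * ·) (fun i => a i ⊗ₜ[k] u i) = fun j =>
        Fin.contractNth i.castSucc (· * ·) a j ⊗ₜ[k] Fin.contractNth i.castSucc (· * ·) u j := by
      ext j
      simp only [Fin.contractNth]
      split_ifs <;> simp
    rw [cross_tmul, coface_apply, coface_apply, e, cross_tmul]
    simp only [LinearMap.compMultilinearMap_apply, MultilinearMap.mkPiAlgebraFin_apply,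
      prod_ofFn_contractNth]

theorem traceMap_app_tmul (τ : E →ₗ[k] k) (hτ : ∀ u v, τ (u * v) = τ (v * u))
    (f : Cochain k H A n) (a : Fin (n + 1) → A) (u : Fin (n + 1) → E) :
    (traceMap (hS := hS) (hA := hA) τ hτ).app n f (fun i => a i ⊗ₜ u i) =
      τ (List.ofFn u).prod • f a := by
  rw [traceMap, cross_tmul]
  simp

end Trace

/-! ### Invariant elements of an `H`-algebra. -/

section Invariants

variable {k : Type*} [Field k] {H : Type*} [Ring H] [HopfAlgebra k H]
variable {B : Type*} [Ring B] [Algebra k B]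
variable {hS : Function.Bijective (antipode k : H →ₗ[k] H)} {hB : HAlgebra k H B} {n : ℕ}

theorem sum_smul_counit (h : H) :
    ∑ i ∈ (ℛ k h).index, counit (R := k) ((ℛ k h).right i) • (ℛ k h).left i = h := by
  have := congrArg (TensorProduct.rid k H) (sum_tmul_counit_eq (ℛ k h))
  simpa only [map_sum, TensorProduct.rid_tmul, one_smul] using this

theorem HAlgebra.act_mul_eq_sum (h : H) (x y : B) : hB.act h (x * y) =
    ∑ i ∈ (ℛ k h).index, hB.act ((ℛ k h).left i) x * hB.act ((ℛ k h).right i) y := by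
  rw [hB.act_mul, comul_sum]
  simp [map_sum, LinearMap.sum_apply]

variable (hB) in
/-- `H`-invariance of an element. -/
def HAlgebra.IsInvariant (w : B) : Prop := ∀ h : H, hB.act h w = counit (R := k) h • w

namespace HAlgebra.IsInvariant

variable {w w' : B}

theorem one : hB.IsInvariant (1 : B) := hB.act_one

theorem add (hw : hB.IsInvariant w) (hw' : hB.IsInvariant w') : hB.IsInvariant (w + w') :=
  fun h => by rw [map_add, hw, hw', smul_add]

theorem sub (hw : hB.IsInvariant w) (hw' : hB.IsInvariant w') : hB.IsInvariant (w - w') :=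
  fun h => by rw [map_sub, hw, hw', smul_sub]

theorem smul (hw : hB.IsInvariant w) (c : k) : hB.IsInvariant (c • w) :=
  fun h => by rw [map_smul, hw, smul_comm]

theorem act_mul_right (hw : hB.IsInvariant w) (h : H) (x : B) :
    hB.act h (x * w) = hB.act h x * w := by
  conv_rhs => rw [← sum_smul_counit (k := k) h]
  simp only [hB.act_mul_eq_sum, hw _, mul_smul_comm, map_sum, LinearMap.sum_apply, map_smul,
    LinearMap.smul_apply, Finset.sum_mul, smul_mul_assoc]

theorem act_mul_left (hw : hB.IsInvariant w) (h : H) (x : B) :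
    hB.act h (w * x) = w * hB.act h x := by
  conv_rhs => rw [← sum_counit_smul (ℛ k h)]
  simp only [hB.act_mul_eq_sum, hw _, mul_smul_comm, map_sum, LinearMap.sum_apply, map_smul,
    LinearMap.smul_apply, Finset.mul_sum, smul_mul_assoc]

/-- This follows from `ε ∘ S = ε`. It removes the twist by `S⁻¹(g⁽⁰⁾)` whenever an invariant element
sits in the last slot. -/
theorem act_antipodeInv (hw : hB.IsInvariant w) (h : H) :
    hB.act (antipodeInv hS h) w = counit (R := k) h • w := by
  rw [hw, ← counit_antipode (R := k) (antipodeInv hS h)]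
  congr 2
  exact (LinearEquiv.ofBijective (antipode k : H →ₗ[k] H) hS).apply_symm_apply h

end HAlgebra.IsInvariant

end Invariants

/-! ### Insertion of an invariant element into equivariant and cyclic cochains. -/

section Insertion

variable {k : Type*} [Field k] {H : Type*} [Ring H] [HopfAlgebra k H]
variable {B : Type*} [Ring B] [Algebra k B]
variable {hS : Function.Bijective (antipode k : H →ₗ[k] H)} {hB : HAlgebra k H B} {n : ℕ}

theorem sweedler_succ_apply {M : Type*} [AddCommGroup M] [Module k M]
    (Φ : MultilinearMap k (fun _ : Fin (n + 2) => H) M) (h : H) :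
    sweedler k H (n + 1) Φ h = ∑ i ∈ (ℛ k h).index,
      sweedler k H n (Φ.curryLeft ((ℛ k h).left i)) ((ℛ k h).right i) := by
  change lift (sweedler k H n ∘ₗ Φ.curryLeft) (comul (R := k) h) = _
  simp [comul_sum]

/-- The counit axiom for iterated coproducts. -/
theorem sweedler_counit {M : Type*} [AddCommGroup M] [Module k M] (j : Fin (n + 2))
    {Φ : MultilinearMap k (fun _ : Fin (n + 2) => H) M}
    {Ψ : MultilinearMap k (fun _ : Fin (n + 1) => H) M}
    (h : ∀ x, Φ x = counit (R := k) (x j) • Ψ (j.removeNth x)) (g : H) :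
    sweedler k H (n + 1) Φ g = sweedler k H n Ψ g := by
  rw [sweedler_succ_apply]
  cases j using Fin.cases with
  | zero =>
    have e : ∀ x, Φ.curryLeft x = counit (R := k) x • Ψ := by
      intro x
      ext y
      simp [h, Fin.removeNth_zero]
    simp only [e, map_smul, LinearMap.smul_apply]
    simp only [← map_smul, ← map_sum, sum_counit_smul]
  | succ j =>
    -- The left counit axiom treats the first slot, and the right one the last slot when there are
    -- only two. Otherwise the first tensor factor is split off, and the position `j` drops by one.
    induction n generalizing g with
    | zero =>
      have e : ∀ x y, sweedler k H 0 (Φ.curryLeft x) y =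
          counit (R := k) y • sweedler k H 0 Ψ x := by
        intro x y
        refine (h _).trans ?_
        obtain rfl := Fin.fin_one_eq_zero j
        refine congrArg (counit (R := k) y • ·) (congrArg Ψ (funext fun i => ?_))
        obtain rfl := Fin.fin_one_eq_zero i
        rfl
      simp only [e]
      simp only [← map_smul, ← map_sum, sum_smul_counit]
    | succ n ih =>
      rw [sweedler_succ_apply]
      refine Finset.sum_congr rfl fun i _ => ?_
      rw [sweedler_succ_apply]
      have e : ∀ x y, Φ.curryLeft x y = counit (R := k) (y j) • Ψ.curryLeft x (j.removeNth y) := by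
        intro x y
        refine (h _).trans ?_
        rw [Fin.cons_succ, MultilinearMap.curryLeft_apply]
        congr 2
        ext i
        cases i using Fin.cases with
        | zero => simp [Fin.removeNth]
        | succ i => simp [Fin.removeNth]
      cases j using Fin.cases with
      | zero =>
        have e : ∀ x z, (Φ.curryLeft x).curryLeft z = counit (R := k) z • Ψ.curryLeft x := by
          intro x z
          ext y
          simp only [MultilinearMap.curryLeft_apply (Φ.curryLeft x), e]
          simp [Fin.removeNth_zero]
        simp only [e, map_smul, LinearMap.smul_apply]
        simp only [← map_smul, ← map_sum, sum_counit_smul]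
      | succ j => exact ih _ _ (e _)

variable {P : B}

/-- In the slot of `P` the factor of the iterated coproduct acts by its counit, so it disappears by
the counit axiom. -/
theorem curryMid_mem_equivariantCochains (hP : hB.IsInvariant P) (j : Fin (n + 2))
    {f : Cochain k H B (n + 1)} (hf : f ∈ equivariantCochains hB (n + 1)) :
    f.curryMid j P ∈ equivariantCochains hB n := by
  intro h g a
  refine Eq.trans ?_ (hf h g (j.insertNth P a))
  rw [sweedler_counit j]
  intro x
  rw [MultilinearMap.compLinearMap_apply, MultilinearMap.compLinearMap_apply,
    MultilinearMap.curryMid_apply_apply, ← f.map_insertNth_smul]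
  congr 1
  ext i
  cases i using j.succAboveCases with
  | x => simp [hP (x j)]
  | p i => simp [Fin.removeNth]

theorem init_insertNth_castSucc {X : Type*} (j : Fin (n + 1)) (P : X) (a : Fin (n + 1) → X) :
    (Fin.init (j.castSucc.insertNth P a : Fin (n + 2) → X) : Fin (n + 1) → X) =
      j.insertNth P (Fin.init a) := by
  ext i
  cases i using j.succAboveCases with
  | x => simp [Fin.init]
  | p i =>
    rw [Fin.insertNth_apply_succAbove, Fin.init, Fin.init, ← Fin.castSucc_succAbove_castSucc,
      Fin.insertNth_apply_succAbove]

theorem cyclicOp_curryMid_succ (j : Fin (n + 1)) (f : Cochain k H B (n + 1)) :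
    cyclicOp hS hB n (f.curryMid j.succ P) = (cyclicOp hS hB (n + 1) f).curryMid j.castSucc P := by
  ext a g
  simp only [cyclicOp_apply, MultilinearMap.curryMid_apply_apply, Fin.insertNth_succ_cons,
    init_insertNth_castSucc]
  have e : (j.castSucc.insertNth P a : Fin (n + 2) → B) (Fin.last (n + 1)) = a (Fin.last n) := by
    rw [← Fin.succ_last, ← Fin.succAbove_of_le_castSucc _ _
      (Fin.castSucc_le_castSucc_iff.2 (Fin.le_last j)), Fin.insertNth_apply_succAbove]
  rw [e]

/-- The operator carries `P` from the last slot to the front, and invariance makes the twist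
trivial. -/
theorem curryMid_last_cyclicOp (hP : hB.IsInvariant P) (f : Cochain k H B (n + 1)) :
    (cyclicOp hS hB (n + 1) f).curryMid (Fin.last (n + 1)) P = f.curryMid 0 P := by
  ext a g
  simp only [cyclicOp_apply, MultilinearMap.curryMid_apply_apply, Fin.insertNth_last',
    Fin.insertNth_zero', Fin.snoc_last, Fin.init_snoc, hP.act_antipodeInv, f.cons_smul,
    LinearMap.smul_apply]
  simp only [← map_smul, ← map_sum, sum_counit_smul]

/-- The contraction `(ι_P f)(a₀, …, aₙ) = ∑ (-1)ⁱ f(a₀, …, aᵢ, P, aᵢ₊₁, …, aₙ)`. -/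
def contraction (P : B) (f : Cochain k H B (n + 1)) : Cochain k H B n :=
  ∑ i : Fin (n + 1), (-1 : k) ^ (i : ℕ) • f.curryMid i.succ P

/-- The cyclic operator moves the insertion point back by one place, at the cost of the sign
`(-1)ⁿ⁺¹`. The insertion after `a₀` lands in front of `a₀`, and cyclicity of `f` carries it to the
end. Thus the terms of the alternating sum are permuted cyclically, with total sign `(-1)ⁿ`. -/
theorem contraction_mem_cyclicCochains (hP : hB.IsInvariant P) {f : Cochain k H B (n + 1)}
    (hf : f ∈ cyclicCochains hS hB (n + 1)) : contraction P f ∈ cyclicCochains hS hB n := by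
  refine ⟨Submodule.sum_mem _ fun i _ => Submodule.smul_mem _ _
    (curryMid_mem_equivariantCochains hP _ hf.1), ?_⟩
  have hT : cyclicOp hS hB (n + 1) f = (-1 : k) ^ (n + 1) • f := hf.2
  have h0 : f.curryMid 0 P = (-1 : k) ^ (n + 1) • f.curryMid (Fin.last (n + 1)) P := by
    rw [← curryMid_last_cyclicOp (hS := hS) hP, hT]
    rfl
  have h1 : ∀ j : Fin (n + 1), cyclicOp hS hB n (f.curryMid j.succ P) =
      (-1 : k) ^ (n + 1) • f.curryMid j.castSucc P := by
    intro j
    rw [cyclicOp_curryMid_succ, hT]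
    rfl
  change cyclicOp hS hB n (contraction P f) = (-1 : k) ^ n • contraction P f
  simp only [contraction, map_sum, map_smul, h1]
  rw [Fin.sum_univ_succ, Fin.sum_univ_castSucc]
  simp only [Fin.castSucc_zero, h0, Fin.succ_last, Fin.val_last, Fin.val_castSucc, Fin.val_succ,
    Fin.succ_castSucc, smul_add, smul_smul, Finset.smul_sum, Fin.val_zero]
  rw [add_comm]
  congr 1
  · refine Finset.sum_congr rfl fun i _ => ?_
    congr 1
    ring
  · congr 1
    ring

end Insertion

/-! ### Combinatorics of insertions and contractions, on sequences indexed by `ℕ`. -/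

section Sequences

variable {X : Type*}

/-- Insertion of `P` into a sequence after the `i`-th entry. -/
def seqInsert (P : X) (i : ℕ) (a : ℕ → X) (m : ℕ) : X :=
  if m ≤ i then a m else if m = i + 1 then P else a (m - 1)

/-- Multiplication of the `j`-th and the `(j + 1)`-st entry of a sequence. -/
def seqContract [Mul X] (j : ℕ) (a : ℕ → X) (m : ℕ) : X :=
  if m < j then a m else if m = j then a m * a (m + 1) else a (m + 1)

/-- The sequence `(x a₀, a₁, …)`. -/
def seqMulHead [Mul X] (x : X) (a : ℕ → X) (m : ℕ) : X := if m = 0 then x * a 0 else a m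

theorem seqContract_seqInsert_of_le [Mul X] (P : X) {i j : ℕ} (h : j ≤ i) (a : ℕ → X) :
    seqContract j (seqInsert P (i + 1) a) = seqInsert P i (seqContract j a) := by
  funext m
  simp only [seqContract, seqInsert]
  grind

theorem seqContract_seqInsert_of_lt [Mul X] (P : X) {i j : ℕ} (h : i < j) (a : ℕ → X) :
    seqContract (j + 1) (seqInsert P i a) = seqInsert P i (seqContract j a) := by
  funext m
  simp only [seqContract, seqInsert]
  grind

theorem seqContract_seqInsert_self [Mul X] (P : X) (i : ℕ) (a : ℕ → X) :
    seqContract i (seqInsert P i a) = Function.update a i (a i * P) := by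
  funext m
  simp only [seqContract, seqInsert, Function.update_apply]
  grind

theorem seqContract_succ_seqInsert [Mul X] (P : X) (i : ℕ) (a : ℕ → X) :
    seqContract (i + 1) (seqInsert P i a) = Function.update a (i + 1) (P * a (i + 1)) := by
  funext m
  simp only [seqContract, seqInsert, Function.update_apply]
  grind

theorem seqMulHead_seqInsert [Mul X] (x P : X) (i : ℕ) (a : ℕ → X) :
    seqMulHead x (seqInsert P i a) = seqInsert P i (seqMulHead x a) := by
  funext m
  simp only [seqMulHead, seqInsert]
  grind

variable {n : ℕ}

theorem insertNth_eq_seqInsert (P : X) (i : Fin (n + 1)) (a : ℕ → X) :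
    (i.succ.insertNth P (fun m : Fin (n + 1) => a m) : Fin (n + 2) → X) =
      fun m : Fin (n + 2) => seqInsert P i a m := by
  ext m
  cases m using i.succ.succAboveCases with
  | x => simp [seqInsert]
  | p m =>
    rw [Fin.insertNth_apply_succAbove]
    rcases lt_or_ge (i : ℕ) m with h | h
    · rw [Fin.succAbove_of_le_castSucc _ _ (by simp [Fin.le_def]; omega)]
      simp only [seqInsert, Fin.val_succ]
      rw [if_neg (by omega), if_neg (by omega), Nat.add_sub_cancel]
    · rw [Fin.succAbove_of_castSucc_lt _ _ (by simp [Fin.lt_def]; omega)]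
      simp only [seqInsert, Fin.val_castSucc]
      rw [if_pos h]

theorem contractNth_zero_cons_init [Mul X] (x : X) (a : ℕ → X) :
    Fin.contractNth (0 : Fin (n + 1)).castSucc (· * ·)
      (Fin.cons x (Fin.init fun m : Fin (n + 2) => a m) : Fin (n + 2) → X) =
      fun m : Fin (n + 1) => seqMulHead x a m := by
  ext m
  cases m using Fin.cases with
  | zero => rfl
  | succ m => simp [Fin.contractNth, seqMulHead, Fin.init]

/-- The double sum in Cartan's formula for the contraction by an element. -/
theorem sum_neg_one_pow_faces {R : Type*} [CommRing R] (n : ℕ) (F Y : ℕ → ℕ → R)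
    (h₁ : ∀ i j, j ≤ i → i < n → F (i + 1) j = Y i j)
    (h₂ : ∀ i j, i < j → j ≤ n → F i (j + 1) = Y i j) :
    ∑ i ∈ Finset.range (n + 1), ∑ j ∈ Finset.range (n + 2), (-1) ^ (i + j) * F i j =
      ∑ i ∈ Finset.range (n + 1), F i i - ∑ i ∈ Finset.range (n + 1), F i (i + 1) -
        ∑ i ∈ Finset.range n, ∑ j ∈ Finset.range (n + 1), (-1) ^ (i + j) * Y i j := by
  -- Each row splits into `j < i`, the two faces `j = i, i + 1` that touch the inserted element, and
  -- `j ≥ i + 2`. The outer ranges become terms `Y` after shifting `i` or `j` by one, which reverses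
  -- the sign.
  have e1 : ∀ i ∈ Finset.range (n + 1),
      ∑ j ∈ Finset.range (n + 2), (-1) ^ (i + j) * F i j =
        (∑ j ∈ Finset.range i, (-1) ^ (i + j) * F i j) + (F i i - F i (i + 1)) -
          ∑ j ∈ Finset.Ico (i + 1) (n + 1), (-1) ^ (i + j) * Y i j := by
    intro i hi
    have hi' : i < n + 1 := Finset.mem_range.1 hi
    rw [← Finset.sum_range_add_sum_Ico _ (show i + 2 ≤ n + 2 by omega), Finset.sum_range_succ,
      Finset.sum_range_succ, ← Finset.sum_Ico_add' _ (i + 1) (n + 1) 1, sub_eq_add_neg _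
        (∑ j ∈ Finset.Ico (i + 1) (n + 1), _), ← Finset.sum_neg_distrib, ← add_assoc]
    congr 1
    · have e : ((-1 : R)) ^ (i + i) = 1 := by rw [← two_mul, pow_mul]; simp
      rw [pow_succ, e]
      ring
    · refine Finset.sum_congr rfl fun j hj => ?_
      have := Finset.mem_Ico.1 hj
      rw [h₂ i j (by omega) (by omega)]
      ring
  rw [Finset.sum_congr rfl e1]
  have e2 : ∑ i ∈ Finset.range (n + 1), ∑ j ∈ Finset.range i, (-1) ^ (i + j) * F i j =
      - ∑ i ∈ Finset.range n, ∑ j ∈ Finset.range (i + 1), (-1) ^ (i + j) * Y i j := by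
    rw [Finset.sum_range_succ']
    simp only [Finset.range_zero, Finset.sum_empty, add_zero, ← Finset.sum_neg_distrib]
    refine Finset.sum_congr rfl fun i hi => Finset.sum_congr rfl fun j hj => ?_
    rw [h₁ i j (by simpa [Nat.lt_succ_iff] using hj) (by simpa using hi)]
    ring
  have e3 : ∑ i ∈ Finset.range n, ∑ j ∈ Finset.range (n + 1), (-1) ^ (i + j) * Y i j =
      ∑ i ∈ Finset.range n, ∑ j ∈ Finset.range (i + 1), (-1) ^ (i + j) * Y i j +
        ∑ i ∈ Finset.range n, ∑ j ∈ Finset.Ico (i + 1) (n + 1), (-1) ^ (i + j) * Y i j := by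
    rw [← Finset.sum_add_distrib]
    refine Finset.sum_congr rfl fun i hi => ?_
    rw [Finset.sum_range_add_sum_Ico _ (by have := Finset.mem_range.1 hi; omega)]
  rw [Finset.sum_sub_distrib, Finset.sum_add_distrib, Finset.sum_sub_distrib, e2, e3,
    Finset.sum_range_succ (fun i => ∑ j ∈ Finset.Ico (i + 1) (n + 1), (-1) ^ (i + j) * Y i j)]
  simp only [Finset.Ico_self, Finset.sum_empty]
  ring

end Sequences

/-! ### Cartan's formula: the derivation `[P, ·]` is trivial on cohomology. -/

section Cartan

variable {k : Type*} [Field k] {H : Type*} [Ring H] [HopfAlgebra k H]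
variable {B : Type*} [Ring B] [Algebra k B]
variable {hS : Function.Bijective (antipode k : H →ₗ[k] H)} {hB : HAlgebra k H B} {n : ℕ}

variable (hS hB) in
/-- The last coface `f((S⁻¹(g⁽⁰⁾) · aₙ₊₁) a₀, a₁, …, aₙ)(g⁽¹⁾)` on a sequence, with `aₙ₊₁`
replaced by `x`. -/
def seqLastFace (f : (ℕ → B) → H →ₗ[k] k) (g : H) (x : B) (a : ℕ → B) : k :=
  ∑ i ∈ (ℛ k g).index,
    f (seqMulHead (hB.act (antipodeInv hS ((ℛ k g).left i)) x) a) ((ℛ k g).right i)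

/-- The value of a cochain on an initial segment of a sequence. -/
def Cochain.seq (f : Cochain k H B n) (a : ℕ → B) : H →ₗ[k] k := f fun m : Fin (n + 1) => a m

theorem Cochain.seq_congr (f : Cochain k H B n) {a a' : ℕ → B} (h : ∀ m < n + 1, a m = a' m) :
    f.seq a = f.seq a' :=
  congrArg f (funext fun m => h m m.2)

theorem Cochain.seq_update (f : Cochain k H B n) (a : ℕ → B) {i : ℕ} (hi : i < n + 1) (x : B) :
    f.seq (Function.update a i x) =
      f (Function.update (fun m : Fin (n + 1) => a m) ⟨i, hi⟩ x) := by
  refine congrArg f (funext fun m => ?_)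
  simp [Function.update_apply, Fin.ext_iff]

theorem Cochain.seq_curryMid (f : Cochain k H B (n + 1)) (P : B) (i : Fin (n + 1)) :
    Cochain.seq (f.curryMid i.succ P) = fun a => f.seq (seqInsert P i a) :=
  funext fun a => congrArg f (insertNth_eq_seqInsert P i a)

variable (hS hB) in
/-- The cofaces of `f` on a sequence. -/
def seqFace (n : ℕ) (f : (ℕ → B) → H →ₗ[k] k) (g : H) (a : ℕ → B) (j : ℕ) : k :=
  if j ≤ n then f (seqContract j a) g else seqLastFace hS hB f g (a (n + 1)) a

theorem coboundary_seq (f : Cochain k H B n) (a : ℕ → B) (g : H) :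
    (coboundary hS hB n f).seq a g =
      ∑ j ∈ Finset.range (n + 2), (-1) ^ j * seqFace hS hB n f.seq g a j := by
  rw [Finset.sum_range_succ, Finset.sum_range, coboundary_apply]
  rw [Cochain.seq, _root_.add_apply, LinearMap.add_apply, _root_.sum_apply, LinearMap.sum_apply]
  congr 1
  · refine Finset.sum_congr rfl fun j _ => ?_
    rw [seqFace, if_pos (by omega)]
    rfl
  · rw [seqFace, if_neg (by omega), _root_.smul_apply, LinearMap.smul_apply, smul_eq_mul,
      cyclicOp_apply, seqLastFace]
    congr 1
    refine Finset.sum_congr rfl fun i _ => ?_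
    rw [coface_apply, contractNth_zero_cons_init]
    rfl

variable {P : B}

/-- Cartan's formula for the contraction by an invariant element, evaluated on a cocycle. -/
theorem sum_lie_eq_neg_faces (hP : hB.IsInvariant P) {f : Cochain k H B n}
    (hf : coboundary hS hB n f = 0) (a : ℕ → B) (g : H) :
    ∑ i ∈ Finset.range (n + 1), f.seq (Function.update a i (P * a i - a i * P)) g =
      - ∑ i ∈ Finset.range n, ∑ j ∈ Finset.range (n + 1), (-1) ^ (i + j) *
        (if j < n then f.seq (seqInsert P i (seqContract j a)) g else
          seqLastFace hS hB (fun a => f.seq (seqInsert P i a)) g (a n) a) := by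
  let F : ℕ → ℕ → k := fun i j => seqFace hS hB n f.seq g (seqInsert P i a) j
  have h0 := sum_neg_one_pow_faces n F (fun i j =>
      (if j < n then f.seq (seqInsert P i (seqContract j a)) g else
          seqLastFace hS hB (fun a => f.seq (seqInsert P i a)) g (a n) a)) (by
    intro i j hj hi
    simp only [F, seqFace]
    rw [if_pos (by omega), if_pos (by omega), seqContract_seqInsert_of_le _ hj]) (by
    intro i j hi hj
    simp only [F, seqFace]
    rcases hj.lt_or_eq with hj | rfl
    · rw [if_pos (by omega), if_pos (by omega), seqContract_seqInsert_of_lt _ hi]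
    -- The wrap-around face: as the insertion is made before the last entry, that entry is the same
    -- for both sides, up to the shift of its index.
    · rw [if_neg (by omega), if_neg (by omega)]
      have : seqInsert P i a (j + 1) = a j := by simp only [seqInsert]; grind
      simp only [seqLastFace, seqMulHead_seqInsert, this])
  -- Each row is, up to sign, the coboundary of `f` on the sequence with `P` inserted after the
  -- `i`-th entry.
  have h1 : ∑ i ∈ Finset.range (n + 1), ∑ j ∈ Finset.range (n + 2), (-1) ^ (i + j) * F i j = 0 := by
    refine Finset.sum_eq_zero fun i _ => ?_
    simp only [pow_add, mul_assoc, ← Finset.mul_sum]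
    rw [← coboundary_seq, hf]
    simp [Cochain.seq]
  have h2 : ∑ i ∈ Finset.range (n + 1), F i i =
      ∑ i ∈ Finset.range (n + 1), f.seq (Function.update a i (a i * P)) g := by
    refine Finset.sum_congr rfl fun i hi => ?_
    have := Finset.mem_range.1 hi
    simp only [F, seqFace]
    rw [if_pos (by omega), seqContract_seqInsert_self]
  have h3 : ∑ i ∈ Finset.range (n + 1), F i (i + 1) =
      ∑ i ∈ Finset.range (n + 1), f.seq (Function.update a i (P * a i)) g := by
    -- The term `i = n` on the left has `P` in the last slot. The last face carries it in front of
    -- `a₀`, so it matches the term `i = 0` on the right.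
    rw [Finset.sum_range_succ, Finset.sum_range_succ']
    congr 1
    · refine Finset.sum_congr rfl fun i hi => ?_
      have := Finset.mem_range.1 hi
      simp only [F, seqFace]
      rw [if_pos (by omega), seqContract_succ_seqInsert]
    · have e1 : seqInsert P n a (n + 1) = P := by simp [seqInsert]
      have e2 : ∀ c : k, f.seq (seqMulHead (c • P) (seqInsert P n a)) =
          c • f.seq (Function.update a 0 (P * a 0)) := by
        intro c
        rw [f.seq_update a n.succ_pos, ← f.map_update_smul, ← f.seq_update a n.succ_pos]
        refine f.seq_congr fun m hm => ?_
        simp only [seqMulHead, seqInsert, Function.update_apply, smul_mul_assoc]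
        grind
      simp only [F, seqFace]
      rw [if_neg (by omega), e1, seqLastFace]
      simp only [hP.act_antipodeInv, e2, LinearMap.smul_apply]
      simp only [← map_smul, ← map_sum, sum_counit_smul]
  have h4 : ∑ i ∈ Finset.range (n + 1), f.seq (Function.update a i (P * a i - a i * P)) g =
      ∑ i ∈ Finset.range (n + 1), f.seq (Function.update a i (P * a i)) g -
      ∑ i ∈ Finset.range (n + 1), f.seq (Function.update a i (a i * P)) g := by
    rw [← Finset.sum_sub_distrib]
    refine Finset.sum_congr rfl fun i hi => ?_
    simp only [f.seq_update a (Finset.mem_range.1 hi), f.map_update_sub, LinearMap.sub_apply]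
  rw [h4, ← h3, ← h2]
  rw [h1] at h0
  linear_combination h0

variable (P) in
/-- The derivation `[P, ·]` on cochains. -/
def lieDeriv (f : Cochain k H B n) : Cochain k H B n :=
  ∑ i : Fin (n + 1), f.compLinearMap (Function.update (fun _ => LinearMap.id) i
    (LinearMap.mulLeft k P - LinearMap.mulRight k P))

theorem lieDeriv_apply (f : Cochain k H B n) (a : Fin (n + 1) → B) :
    lieDeriv P f a = ∑ i, f (Function.update a i (P * a i - a i * P)) := by
  rw [lieDeriv, _root_.sum_apply]
  refine Finset.sum_congr rfl fun i _ => congrArg f (funext fun m => ?_)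
  rcases eq_or_ne m i with rfl | h
  · simp
  · simp [h]

/-- By Cartan's formula a primitive is `-ι_P f`, which is cyclic because `f` is. In degree `0` the
double sum is empty, so the derivative itself vanishes. -/
theorem lieDeriv_mem_cyclicCoboundaries (hP : hB.IsInvariant P) {f : Cochain k H B n}
    (hf : f ∈ cyclicCocycles hS hB n) : lieDeriv P f ∈ cyclicCoboundaries hS hB n := by
  have key : ∀ (a : Fin (n + 1) → B) (g : H), ∃ b : ℕ → B, a = (fun m : Fin (n + 1) => b m) ∧
      lieDeriv P f a g = - ∑ i ∈ Finset.range n, ∑ j ∈ Finset.range (n + 1), (-1) ^ (i + j) *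
        (if j < n then f.seq (seqInsert P i (seqContract j b)) g else
          seqLastFace hS hB (fun b => f.seq (seqInsert P i b)) g (b n) b) := by
    intro a g
    -- The padding by `0` is harmless: the formula reads only the entries of index at most `n`.
    let b : ℕ → B := fun m => if h : m < n + 1 then a ⟨m, h⟩ else 0
    have hb : a = fun m : Fin (n + 1) => b m := by
      ext m
      simp only [b]
      rw [dif_pos m.2]
    refine ⟨b, hb, ?_⟩
    rw [← sum_lie_eq_neg_faces hP hf.2, lieDeriv_apply, Finset.sum_range, LinearMap.sum_apply]
    refine Finset.sum_congr rfl fun i _ => ?_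
    rw [f.seq_update b i.2, hb]
  cases n with
  | zero =>
    change lieDeriv P f = 0
    ext a g
    obtain ⟨b, -, h⟩ := key a g
    simpa using h
  | succ n =>
    refine ⟨-contraction P f, Submodule.neg_mem _ (contraction_mem_cyclicCochains hP hf.1), ?_⟩
    ext a g
    obtain ⟨b, rfl, h⟩ := key a g
    rw [h, map_neg, contraction, map_sum]
    simp only [map_smul]
    rw [_root_.neg_apply, _root_.sum_apply, LinearMap.neg_apply, LinearMap.sum_apply,
      Finset.sum_range]
    congr 1
    refine Finset.sum_congr rfl fun i _ => ?_
    rw [_root_.smul_apply, LinearMap.smul_apply, smul_eq_mul]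
    refine (congrArg _ (coboundary_seq (hS := hS) (hB := hB) (f.curryMid i.succ P) b g)).trans ?_
    rw [Finset.mul_sum]
    refine Finset.sum_congr rfl fun j _ => ?_
    rw [pow_add, mul_assoc, Cochain.seq_curryMid, seqFace]
    simp only [Nat.lt_succ_iff]

end Cartan

/-- The coefficients of a polynomial with values in a submodule lie in this submodule. -/
theorem coeff_mem_of_forall_sum_mem {k : Type*} [Field k] [CharZero k] {V : Type*}
    [AddCommGroup V] [Module k V] (Z : Submodule k V) (N : ℕ) (v : ℕ → V)
    (h : ∀ t : k, t ≠ 0 → ∑ m ∈ Finset.range N, t ^ m • v m ∈ Z) {m : ℕ} (hm : m < N) :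
    v m ∈ Z := by
  rw [← Submodule.Quotient.mk_eq_zero, ← Submodule.mkQ_apply,
    ← Module.forall_dual_apply_eq_zero_iff k]
  intro φ
  let p : Polynomial k := ∑ m ∈ Finset.range N, Polynomial.monomial m (φ (Z.mkQ (v m)))
  have hp : p = 0 := by
    -- Modulo `Z`, and after applying a linear functional, every nonzero `t` is a root; there are
    -- infinitely many since `k` has characteristic zero.
    refine p.eq_zero_of_infinite_isRoot
      ((Set.finite_singleton (0 : k)).infinite_compl.mono fun t ht => ?_)
    have := congrArg φ ((Submodule.Quotient.mk_eq_zero Z).2 (h t ht))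
    rw [← Submodule.mkQ_apply] at this
    simp only [map_sum, map_smul, smul_eq_mul, map_zero] at this
    simpa [p, Polynomial.eval_finsetSum, mul_comm] using this
  have := congrArg (fun q => q.coeff m) hp
  simpa [p, Polynomial.finsetSum_coeff, Polynomial.coeff_monomial, hm] using this

/-! ### Weight decomposition and conjugation by invariant elements. -/

section Conjugation

variable {k : Type*} [Field k] {H : Type*} [Ring H] [HopfAlgebra k H]
variable {B : Type*} [Ring B] [Algebra k B]
variable {hS : Function.Bijective (antipode k : H →ₗ[k] H)} {hB : HAlgebra k H B} {n : ℕ}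

variable (k) in
/-- The homomorphism `x ↦ w x w'`, where `w' w = 1`. -/
def conj (w w' : B) (h : w' * w = 1) : B →ₙₐ[k] B where
  toFun x := w * x * w'
  map_zero' := by simp
  map_add' x y := by simp [mul_add, add_mul]
  map_mul' x y := by
    rw [show w * x * w' * (w * y * w') = w * x * (w' * w) * y * w' by simp only [mul_assoc], h]
    simp only [mul_assoc, one_mul]
  map_smul' c x := by simp

theorem conj_apply (w w' : B) (h : w' * w = 1) (x : B) : conj k w w' h x = w * x * w' := rfl

theorem intertwines_conj {w w' : B} (hw : hB.IsInvariant w) (hw' : hB.IsInvariant w')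
    (h : w' * w = 1) : hB.Intertwines hB (conj k w w' h : B →ₗ[k] B) := fun g x => by
  change w * hB.act g x * w' = hB.act g (w * x * w')
  rw [hw'.act_mul_right, hw.act_mul_left]

variable {P : B}

variable (k P) in
/-- The projection of `B` onto the eigenspace of `[P, ·]` of eigenvalue `e - 1`, for an
idempotent `P`. -/
def peirce (e : Fin 3) : B →ₗ[k] B :=
  ![LinearMap.mulLeft k (1 - P) ∘ₗ LinearMap.mulRight k P,
    LinearMap.mulLeft k P ∘ₗ LinearMap.mulRight k P +
      LinearMap.mulLeft k (1 - P) ∘ₗ LinearMap.mulRight k (1 - P),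
    LinearMap.mulLeft k P ∘ₗ LinearMap.mulRight k (1 - P)] e

theorem peirce_commutator (hPP : P * P = P) (e : Fin 3) (x : B) :
    peirce k P e (P * x - x * P) = ((e : ℕ) - 1 : k) • peirce k P e x := by
  have h1 : ∀ y, P * (P * y) = P * y := fun y => by rw [← mul_assoc, hPP]
  fin_cases e
  · simp [peirce, mul_sub, sub_mul, mul_assoc, hPP, h1]
  · simp [peirce, mul_sub, sub_mul, mul_assoc, hPP, h1]
  · norm_num
    simp [peirce, mul_sub, mul_assoc, hPP, h1]

theorem smul_add_one_sub_mul (hPP : P * P = P) {s t : k} (h : s * t = 1) :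
    (s • P + (1 - P)) * (t • P + (1 - P)) = 1 := by
  simp [mul_add, add_mul, mul_sub, sub_mul, hPP, smul_smul, mul_comm t s, h]

/-- Conjugation by `t P + (1 - P)` scales the three Peirce components by `t⁻¹`, `1` and `t`. The
extra factor `t` clears the negative power, so that the result is polynomial in `t`. -/
theorem smul_conj_eq_sum_peirce (hPP : P * P = P) {t : k} (ht : t ≠ 0) (x : B) :
    t • conj k (t • P + (1 - P)) (t⁻¹ • P + (1 - P))
      (smul_add_one_sub_mul hPP (inv_mul_cancel₀ ht)) x =
      ∑ e : Fin 3, t ^ (e : ℕ) • peirce k P e x := by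
  have e1 : ∀ y z : B, (t • P + y) * x * (t⁻¹ • P + z) =
      P * x * P + t • (P * x * z) + t⁻¹ • (y * x * P) + y * x * z := by
    intro y z
    simp only [add_mul, mul_add, smul_mul_assoc, mul_smul_comm, smul_add, smul_smul, inv_mul_cancel₀ ht,
      one_smul]
    abel
  rw [conj_apply, e1, Fin.sum_univ_three]
  simp only [peirce, smul_add, smul_smul, mul_inv_cancel₀ ht, one_smul, Fin.val_zero, pow_zero,
    Fin.val_one, pow_one, Fin.val_two, sq, Matrix.cons_val_zero, Matrix.cons_val_one,
    Matrix.cons_val, LinearMap.comp_apply, LinearMap.add_apply, LinearMap.mulLeft_apply,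
    LinearMap.mulRight_apply, ← mul_assoc]
  abel

variable (P) in
/-- The component of weight `m - (n + 1)` of a cochain with respect to the derivation `[P, ·]`,
for an idempotent `P`. -/
def weightComponent (f : Cochain k H B n) (m : ℕ) : Cochain k H B n :=
  ∑ ε : Fin (n + 1) → Fin 3 with ∑ i, (ε i : ℕ) = m, f.compLinearMap fun i => peirce k P (ε i)

/-- Each slot contributes its eigenvalue `ε i - 1`, and over the `n + 1` slots these add up to `m -
(n + 1)`. -/
theorem lieDeriv_weightComponent (hPP : P * P = P) (f : Cochain k H B n) (m : ℕ) :
    lieDeriv P (weightComponent P f m) = ((m : k) - (n + 1)) • weightComponent P f m := by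
  ext a : 1
  rw [lieDeriv_apply, _root_.smul_apply]
  simp only [weightComponent, _root_.sum_apply, MultilinearMap.compLinearMap_apply]
  rw [Finset.sum_comm, Finset.smul_sum]
  refine Finset.sum_congr rfl fun ε hε => ?_
  have e : ∀ i x, (fun j => peirce k P (ε j) (Function.update a i x j)) =
      Function.update (fun j => peirce k P (ε j) (a j)) i (peirce k P (ε i) x) := by
    intro i x
    ext j
    rcases eq_or_ne j i with rfl | h
    · simp
    · simp [h]
  simp only [e, peirce_commutator hPP, f.map_update_smul, Function.update_eq_self]
  rw [← Finset.sum_smul, ← (Finset.mem_filter.1 hε).2]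
  simp

theorem smul_pullback_conj_eq_sum (hPP : P * P = P) (hP : hB.IsInvariant P) {t : k} (ht : t ≠ 0)
    (f : Cochain k H B n) :
    t ^ (n + 1) • (pullback (hS := hS) (conj k (t • P + (1 - P)) (t⁻¹ • P + (1 - P))
      (smul_add_one_sub_mul hPP (inv_mul_cancel₀ ht))) (intertwines_conj
        ((hP.smul _).add (.sub .one hP)) ((hP.smul _).add (.sub .one hP)) _)).app n f =
      ∑ m ∈ Finset.range (2 * (n + 1) + 1), t ^ m • weightComponent P f m := by
  ext a : 1
  rw [_root_.smul_apply, pullback_app_apply]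
  have e := f.map_smul_univ (fun _ => t) fun i => conj k (t • P + (1 - P)) (t⁻¹ • P + (1 - P))
      (smul_add_one_sub_mul hPP (inv_mul_cancel₀ ht)) (a i)
  rw [Finset.prod_const, Finset.card_univ, Fintype.card_fin] at e
  rw [← e]
  simp only [smul_conj_eq_sum_peirce hPP ht, f.map_sum, f.map_smul_univ, Finset.prod_pow_eq_pow_sum]
  rw [_root_.sum_apply, ← Finset.sum_fiberwise_of_maps_to (t := Finset.range (2 * (n + 1) + 1))
    (g := fun ε : Fin (n + 1) → Fin 3 => ∑ i, (ε i : ℕ))]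
  · refine Finset.sum_congr rfl fun m _ => ?_
    rw [weightComponent, Finset.smul_sum, _root_.sum_apply]
    refine Finset.sum_congr rfl fun ε hε => ?_
    rw [(Finset.mem_filter.1 hε).2]
    rfl
  · intro ε _
    -- Every index `ε i` is at most `2`, so the total degree in `t` is at most `2 (n + 1)`.
    have := Finset.sum_le_card_nsmul Finset.univ (fun i => (ε i : ℕ)) 2 fun i _ => by omega
    simp only [Finset.card_univ, Fintype.card_fin, smul_eq_mul] at this
    exact Finset.mem_range.2 (by omega)

variable [CharZero k]

/-- Pullback along a conjugation by invariant elements preserves cocycles, and the weight components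
are the coefficients of the resulting polynomial in `t`. -/
theorem weightComponent_mem_cyclicCocycles (hPP : P * P = P) (hP : hB.IsInvariant P)
    {f : Cochain k H B n} (hf : f ∈ cyclicCocycles hS hB n) {m : ℕ} (hm : m < 2 * (n + 1) + 1) :
    weightComponent P f m ∈ cyclicCocycles hS hB n := by
  refine coeff_mem_of_forall_sum_mem _ _ _ (fun t ht => ?_) hm
  rw [← smul_pullback_conj_eq_sum (hS := hS) hPP hP ht]
  exact Submodule.smul_mem _ _ (CocyclicHom.map_cyclicCocycles _ hf)

/-- The derivation `[P, ·]` makes the component a coboundary and also multiplies it by `m - (n +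
1)`, which is invertible in characteristic zero. -/
theorem weightComponent_mem_cyclicCoboundaries (hPP : P * P = P) (hP : hB.IsInvariant P)
    {f : Cochain k H B n} (hf : f ∈ cyclicCocycles hS hB n) {m : ℕ} (hm : m < 2 * (n + 1) + 1)
    (hmn : m ≠ n + 1) : weightComponent P f m ∈ cyclicCoboundaries hS hB n := by
  have h := lieDeriv_mem_cyclicCoboundaries hP (weightComponent_mem_cyclicCocycles hPP hP hf hm)
  rw [lieDeriv_weightComponent hPP] at h
  refine (Submodule.smul_mem_iff _ ?_).1 h
  rw [sub_ne_zero]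
  exact_mod_cast hmn

/-- Conjugation by an invariant involution acts trivially on equivariant cyclic cohomology. -/
theorem pullback_conj_sub_mem_cyclicCoboundaries {w : B} (hw : hB.IsInvariant w)
    (hww : w * w = 1) {f : Cochain k H B n} (hf : f ∈ cyclicCocycles hS hB n) :
    (pullback (hS := hS) (conj k w w hww) (intertwines_conj hw hw hww)).app n f - f ∈
      cyclicCoboundaries hS hB n := by
  -- The projection onto the `-1` eigenspace of `w`, so that `w = t P + (1 - P)` with `t = -1`.
  let P : B := (2⁻¹ : k) • (1 - w)
  have hP : hB.IsInvariant P := (HAlgebra.IsInvariant.one.sub hw).smul _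
  have hPP : P * P = P := by
    simp only [P, smul_mul_smul_comm, mul_sub, sub_mul, hww, one_mul, mul_one]
    rw [show (1 : B) - w - (w - 1) = (2 : k) • (1 - w) by rw [two_smul]; abel, smul_smul]
    norm_num
  have hPw : (-1 : k) • P + (1 - P) = w := by
    have : P + P = 1 - w := by rw [← two_smul k P, smul_smul]; simp
    rw [neg_smul, one_smul, ← sub_sub_cancel 1 w, ← this]
    abel
  have hPw' : (-1 : k)⁻¹ • P + (1 - P) = w := by rw [inv_neg, inv_one, hPw]
  -- The case `t = 1`, where the conjugation is the identity.
  have h1 : f = ∑ m ∈ Finset.range (2 * (n + 1) + 1), weightComponent P f m := by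
    have := smul_pullback_conj_eq_sum (hS := hS) hPP hP (one_ne_zero (α := k)) f
    simp only [one_pow, one_smul] at this
    rw [← this]
    ext a : 1
    rw [pullback_app_apply]
    exact congrArg f (funext fun i => by simp [conj_apply])
  have h2 : (pullback (hS := hS) (conj k w w hww) (intertwines_conj hw hw hww)).app n f =
      ∑ m ∈ Finset.range (2 * (n + 1) + 1), ((-1) ^ (n + 1) * (-1) ^ m : k) •
        weightComponent P f m := by
    have := smul_pullback_conj_eq_sum (hS := hS) hPP hP (neg_ne_zero.2 (one_ne_zero (α := k))) f
    simp only [mul_smul, ← Finset.smul_sum]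
    rw [← this, smul_smul, ← mul_pow, neg_one_mul, neg_neg, one_pow, one_smul]
    ext a : 1
    rw [pullback_app_apply, pullback_app_apply]
    exact congrArg f (funext fun i => by rw [conj_apply, conj_apply, hPw, hPw'])
  rw [h2]
  nth_rw 2 [h1]
  rw [← Finset.sum_sub_distrib]
  refine Submodule.sum_mem _ fun m hm => ?_
  nth_rw 2 [← one_smul k (weightComponent P f m)]
  rw [← sub_smul]
  -- In weight zero the sign is `(-1)²⁽ⁿ⁺¹⁾ = 1` and the difference vanishes; all other components
  -- are coboundaries.
  rcases eq_or_ne m (n + 1) with rfl | hmn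
  · rw [← pow_add, Even.neg_one_pow ⟨n + 1, rfl⟩, sub_self, zero_smul]
    exact zero_mem _
  · exact Submodule.smul_mem _ _ (weightComponent_mem_cyclicCoboundaries hPP hP hf
      (Finset.mem_range.1 hm) hmn)

end Conjugation

/-! ### Matrix units of `End V`. -/

section MatrixUnits

variable {k : Type*} [Field k] {V : Type*} [AddCommGroup V] [Module k V]
variable {ι : Type*} (b : Module.Basis ι k V)

/-- The matrix units of `End V`. -/
def matrixUnit (p q : ι) : Module.End k V := (b.coord q).smulRight (b p)

theorem matrixUnit_apply (p q : ι) (v : V) : matrixUnit b p q v = b.repr v q • b p := rfl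

theorem matrixUnit_mul [DecidableEq ι] (p q r s : ι) :
    matrixUnit b p q * matrixUnit b r s = if r = q then matrixUnit b p s else 0 := by
  refine b.ext fun j => ?_
  simp only [Module.End.mul_apply, matrixUnit_apply, map_smul, b.repr_self, smul_smul]
  split_ifs with h <;> simp [matrixUnit_apply, Finsupp.single_apply, h]

theorem trace_matrixUnit_self (p : ι) [Finite ι] :
    LinearMap.trace k V (matrixUnit b p p) = 1 := by
  have := Module.Finite.of_basis b
  have := Module.Free.of_basis b
  rw [matrixUnit, LinearMap.trace_smulRight]
  simp

variable [Fintype ι]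

theorem sum_matrixUnit_self : ∑ p, matrixUnit b p p = 1 := by
  classical
  refine b.ext fun j => ?_
  simp [LinearMap.sum_apply, matrixUnit_apply, Finsupp.single_apply]

theorem eq_sum_matrixUnit (u : Module.End k V) :
    u = ∑ p, ∑ q, b.repr (u (b q)) p • matrixUnit b p q := by
  classical
  refine b.ext fun j => ?_
  simp [LinearMap.sum_apply, matrixUnit_apply, Finsupp.single_apply, b.sum_repr]

end MatrixUnits

/-! ### The flip of two matrix factors as an inner automorphism. -/

section Flip

variable (k : Type*) [Field k] {E : Type*} [Ring E] [Algebra k E]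
variable {ι : Type*} [Fintype ι] [DecidableEq ι]

/-- A system of matrix units which spans the algebra `E`. -/
structure IsMatrixUnits (m : ι → ι → E) : Prop where
  mul : ∀ p q r s, m p q * m r s = if r = q then m p s else 0
  sum_self : ∑ p, m p p = 1
  span : ∀ u, ∃ c : ι → ι → k, u = ∑ p, ∑ q, c p q • m p q

variable {k}

theorem isMatrixUnits_matrixUnit {V : Type*} [AddCommGroup V] [Module k V]
    (b : Module.Basis ι k V) : IsMatrixUnits k (matrixUnit b) where
  mul := matrixUnit_mul b
  sum_self := sum_matrixUnit_self b
  span u := ⟨_, eq_sum_matrixUnit b u⟩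

variable {A : Type*} [Ring A] [Algebra k A]

variable (k A) in
/-- The element of `(A ⊗ E) ⊗ E` which flips the two factors `E`. -/
def flipElement (m : ι → ι → E) : (A ⊗[k] E) ⊗[k] E :=
  ∑ p, ∑ q, (1 ⊗ₜ m p q) ⊗ₜ m q p

variable {m : ι → ι → E}

theorem IsMatrixUnits.flipElement_mul (hm : IsMatrixUnits k m) (a : A) (u v : E) :
    flipElement k A m * ((a ⊗ₜ u) ⊗ₜ v) = ((a ⊗ₜ v) ⊗ₜ u) * flipElement k A m := by
  -- On matrix units both sides equal `(a ⊗ m r q) ⊗ m p s`; the general case follows by linearity.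
  have key : ∀ p q r s, flipElement k A m * ((a ⊗ₜ m p q) ⊗ₜ m r s) =
      ((a ⊗ₜ m r s) ⊗ₜ m p q) * flipElement k A m := by
    intro p q r s
    simp only [flipElement, Finset.sum_mul, Finset.mul_sum, Algebra.TensorProduct.tmul_mul_tmul,
      hm.mul, tmul_ite, ite_tmul]
    simp
  have key' : ∀ p q, flipElement k A m * ((a ⊗ₜ m p q) ⊗ₜ v) =
      ((a ⊗ₜ v) ⊗ₜ m p q) * flipElement k A m := by
    intro p q
    obtain ⟨d, rfl⟩ := hm.span v
    simp only [tmul_sum, sum_tmul, tmul_smul, ← smul_tmul', Finset.mul_sum, Finset.sum_mul,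
      mul_smul_comm, smul_mul_assoc, key]
  obtain ⟨c, rfl⟩ := hm.span u
  simp only [tmul_sum, sum_tmul, tmul_smul, ← smul_tmul', Finset.mul_sum, Finset.sum_mul,
    mul_smul_comm, smul_mul_assoc, key']

theorem IsMatrixUnits.flipElement_mul_self (hm : IsMatrixUnits k m) :
    flipElement k A m * flipElement k A m = 1 := by
  have e : flipElement k A m * flipElement k A m =
      ∑ q, ∑ p, ((1 : A) ⊗ₜ[k] m p p) ⊗ₜ[k] m q q := by
    simp only [flipElement, Finset.sum_mul, Finset.mul_sum, Algebra.TensorProduct.tmul_mul_tmul,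
      hm.mul, tmul_ite, ite_tmul, one_mul]
    simp
  simp only [e, ← tmul_sum, ← sum_tmul, hm.sum_self, Algebra.TensorProduct.one_def]

end Flip

/-! ### The inverse of the trace map, and the reduction of the twisted case. -/

section Morita

variable {k : Type*} [Field k] {H : Type*} [Ring H] [HopfAlgebra k H]
variable {A : Type*} [Ring A] [Algebra k A]
variable {hS : Function.Bijective (antipode k : H →ₗ[k] H)} {hA : HAlgebra k H A} {n : ℕ}

section Inclusion

variable {E : Type*} [Ring E] [Algebra k E]

variable (k A) in
/-- The homomorphism `a ↦ a ⊗ e` defined by an idempotent `e`. -/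
def inclTmul (e : E) (he : e * e = e) : A →ₙₐ[k] A ⊗[k] E where
  toFun a := a ⊗ₜ e
  map_zero' := zero_tmul _ _
  map_add' x y := add_tmul _ _ _
  map_mul' x y := by rw [Algebra.TensorProduct.tmul_mul_tmul, he]
  map_smul' c x := (smul_tmul' _ _ _).symm

theorem intertwines_inclTmul (e : E) (he : e * e = e) :
    hA.Intertwines (hA.tensorRight E) (inclTmul k A e he : A →ₗ[k] A ⊗[k] E) :=
  fun _ _ => rfl

variable (hS hA) in
/-- The restriction of cochains along `a ↦ a ⊗ e`. -/
abbrev inclPullback (e : E) (he : e * e = e) : CocyclicHom hS (hA.tensorRight E) hA :=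
  pullback (inclTmul k A e he) (intertwines_inclTmul e he)

theorem inclPullback_traceMap [Module.Finite k E] {τ : E →ₗ[k] k}
    (hτ : ∀ u v, τ (u * v) = τ (v * u)) {e : E} (he : e * e = e) (hτe : τ e = 1)
    (f : Cochain k H A n) :
    (inclPullback hS hA e he).app n ((traceMap (hS := hS) (hA := hA) τ hτ).app n f) = f := by
  ext a : 1
  rw [pullback_app_apply]
  refine (traceMap_app_tmul τ hτ f a fun _ => e).trans ?_
  rw [List.ofFn_const, List.prod_replicate, IsIdempotentElem.pow_succ_eq n he, hτe, one_smul]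

/-- The action involves only the factor `A`, in which the flip element has entry `1`. -/
theorem isInvariant_flipElement {ι : Type*} [Fintype ι] (m : ι → ι → E) :
    ((hA.tensorRight E).tensorRight E).IsInvariant (flipElement k A m) := by
  intro h
  simp only [flipElement, map_sum, Finset.smul_sum, HAlgebra.tensorRight_act_tmul, hA.act_one,
    ← smul_tmul']

/-- Both cochains are restrictions along `x ↦ x ⊗ e` of the trace extension of `f` to `(A ⊗ E) ⊗ E`,
one with and one without a preceding pullback along the flip. The flip is conjugation by an
invariant involution, hence trivial on cohomology. -/
theorem IsMatrixUnits.traceMap_inclPullback_sub_mem [CharZero k] [Module.Finite k E] {ι : Type*}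
    [Fintype ι] [DecidableEq ι] {m : ι → ι → E} (hm : IsMatrixUnits k m) {τ : E →ₗ[k] k}
    (hτ : ∀ u v, τ (u * v) = τ (v * u)) {e : E} (he : e * e = e) (hτe : τ e = 1)
    {f : Cochain k H (A ⊗[k] E) n} (hf : f ∈ cyclicCocycles hS (hA.tensorRight E) n) :
    (traceMap (hS := hS) (hA := hA) τ hτ).app n ((inclPullback hS hA e he).app n f) - f ∈
      cyclicCoboundaries hS (hA.tensorRight E) n := by
  have hww := hm.flipElement_mul_self (A := A)
  have hF := (traceMap (hS := hS) τ hτ).map_cyclicCocycles hf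
  have h := (inclPullback hS _ e he).map_cyclicCoboundaries
    (pullback_conj_sub_mem_cyclicCoboundaries (isInvariant_flipElement m) hww hF)
  rw [map_sub, inclPullback_traceMap _ he hτe] at h
  convert h using 2
  refine multilinear_ext_tmul fun a u => ?_
  rw [traceMap_app_tmul, pullback_app_apply, pullback_app_apply, pullback_app_apply]
  refine (traceMap_app_tmul _ _ f (fun i => a i ⊗ₜ e) u).symm.trans (congrArg _ (funext fun i => ?_))
  -- The flip exchanges `u i` and `e`: the trace now sees the `u i`, and `f` sees the elements `a i
  -- ⊗ e`.
  change (a i ⊗ₜ e) ⊗ₜ u i = flipElement k A m * ((a i ⊗ₜ u i) ⊗ₜ e) * flipElement k A m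
  rw [hm.flipElement_mul, mul_assoc, hww, mul_one]

end Inclusion

section Twisted

variable {B : Type*} [Ring B] [Algebra k B] {hB : HAlgebra k H B}

/-- Under a trivial action `c_<1>` enters only through its counit, so the coaction disappears by the
counit axiom of the comodule. -/
theorem twistedMul_eq_mul (hB' : ∀ (h : H) (u : B), hB.act h u = counit (R := k) h • u)
    (ρ : YetterDrinfeld hA) (x y : A ⊗[k] B) : ρ.twistedMul hB x y = x * y := by
  induction y with
  | zero => simp
  | add t t' ht ht' => simp only [map_add, ht, ht', mul_add]
  | tmul c d =>
  induction x with
  | zero => simp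
  | add t t' ht ht' => simp only [map_add, LinearMap.add_apply, ht, ht', add_mul]
  | tmul a b =>
  rw [ρ.twistedMul_tmul_tmul, Algebra.TensorProduct.tmul_mul_tmul]
  have h1 : ∀ t : A ⊗[k] H,
      map (LinearMap.mulLeft k a) (LinearMap.mulRight k d ∘ₗ hB.act.toLinearMap.flip b) t =
        map (LinearMap.mulLeft k a) (LinearMap.toSpanSingleton k B (b * d))
          ((counit (R := k) (A := H)).lTensor A t) := by
    intro t
    induction t with
    | zero => simp
    | add t t' ht ht' => simp only [map_add, ht, ht']
    | tmul x y => simp [hB']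
  rw [h1, ρ.lTensor_counit]
  simp

theorem diag_eq_tensorRight (hB' : ∀ (h : H) (u : B), hB.act h u = counit (R := k) h • u)
    (h : H) (x : A ⊗[k] B) : hA.diag hB h x = (hA.tensorRight B).act h x := by
  induction x with
  | zero => simp
  | add t t' ht ht' => simp only [map_add, ht, ht']
  | tmul a b =>
    rw [HAlgebra.diag_apply, HAlgebra.tensorRight_act_tmul, comul_sum]
    conv_rhs => rw [← sum_smul_counit (k := k) h]
    simp [hB', LinearMap.sum_apply, sum_tmul, smul_tmul]

/-- The identity, as a homomorphism to the twisted tensor product by a trivial `H`-algebra. -/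
def toTwisted (hB' : ∀ (h : H) (u : B), hB.act h u = counit (R := k) h • u)
    (ρ : YetterDrinfeld hA) : A ⊗[k] B →ₙₐ[k] ρ.Twisted hB where
  toFun x := x
  map_zero' := rfl
  map_add' _ _ := rfl
  map_mul' x y := (twistedMul_eq_mul hB' ρ x y).symm
  map_smul' _ _ := rfl

/-- The identity, as a homomorphism from the twisted tensor product by a trivial `H`-algebra. -/
def ofTwisted (hB' : ∀ (h : H) (u : B), hB.act h u = counit (R := k) h • u)
    (ρ : YetterDrinfeld hA) : ρ.Twisted hB →ₙₐ[k] A ⊗[k] B where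
  toFun x := x
  map_zero' := rfl
  map_add' _ _ := rfl
  map_mul' x y := twistedMul_eq_mul hB' ρ x y
  map_smul' _ _ := rfl

theorem intertwines_toTwisted (hB' : ∀ (h : H) (u : B), hB.act h u = counit (R := k) h • u)
    (ρ : YetterDrinfeld hA) : (hA.tensorRight B).Intertwines (ρ.twisted hB)
      (toTwisted hB' ρ : A ⊗[k] B →ₗ[k] ρ.Twisted hB) :=
  fun h x => (diag_eq_tensorRight hB' h x).symm

theorem intertwines_ofTwisted (hB' : ∀ (h : H) (u : B), hB.act h u = counit (R := k) h • u)
    (ρ : YetterDrinfeld hA) : (ρ.twisted hB).Intertwines (hA.tensorRight B)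
      (ofTwisted hB' ρ : ρ.Twisted hB →ₗ[k] A ⊗[k] B) :=
  fun h x => diag_eq_tensorRight hB' h x

theorem conjEnd_act_of_trivial {V : Type*} [AddCommGroup V] [Module k V]
    {r : H →ₐ[k] Module.End k V} (hr : ∀ (h : H) (v : V), r h v = counit (R := k) h • v) (h : H)
    (u : Module.End k V) : (HAlgebra.conjEnd r).act h u = counit (R := k) h • u := by
  have hr' : ∀ h, r h = counit (R := k) h • 1 := fun h => LinearMap.ext fun v => hr h v
  conv_rhs => rw [← sum_smul_counit (k := k) h]
  simp [HAlgebra.conjEnd, comul_sum, hr', LinearMap.sum_apply, Finset.sum_smul, smul_smul]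

end Twisted

end Morita

end EquivariantCyclic

end

open EquivariantCyclic
theorem mainTheorem7
    {k : Type*} [Field k] [CharZero k]
    {H : Type*} [Ring H] [HopfAlgebra k H]
    (hS : Function.Bijective (HopfAlgebra.antipode k : H →ₗ[k] H))
    {A : Type*} [Ring A] [Algebra k A] (hA : HAlgebra k H A)
    {V : Type*} [AddCommGroup V] [Module k V] [FiniteDimensional k V] [Nontrivial V]
    (r : H →ₐ[k] Module.End k V)
    (hr : ∀ (h : H) (v : V), r h v = Coalgebra.counit (R := k) h • v)
    (n : ℕ) :
    (∀ ρ : YetterDrinfeld hA,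
      ∃ e : HC hS hA n ≃ₗ[k] HC hS (ρ.twisted (HAlgebra.conjEnd r)) n,
        ∀ f : cyclicCocycles hS hA n,
          ∃ F : cyclicCocycles hS (ρ.twisted (HAlgebra.conjEnd r)) n,
            (∀ (a : Fin (n + 1) → A) (u : Fin (n + 1) → Module.End k V) (g : H),
              F.1 (fun i => ρ.tw (HAlgebra.conjEnd r) (a i) (u i)) g =
                LinearMap.trace k V (List.ofFn u).prod * f.1 a g) ∧
            e (HC.mk hS hA n f) = HC.mk hS (ρ.twisted (HAlgebra.conjEnd r)) n F) ∧
    ∃ e : HC hS hA n ≃ₗ[k] HC hS (hA.tensorRight (Module.End k V)) n,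
      ∀ f : cyclicCocycles hS hA n,
        ∃ F : cyclicCocycles hS (hA.tensorRight (Module.End k V)) n,
          (∀ (a : Fin (n + 1) → A) (u : Fin (n + 1) → Module.End k V) (g : H),
            F.1 (fun i => a i ⊗ₜ[k] u i) g =
              LinearMap.trace k V (List.ofFn u).prod * f.1 a g) ∧
          e (HC.mk hS hA n f) = HC.mk hS (hA.tensorRight (Module.End k V)) n F := by
  classical
  let b := Module.finBasis k V
  -- Any basis index would serve; one exists because `V` is nonzero.
  let p : Fin (Module.finrank k V) := ⟨0, Module.finrank_pos⟩
  have he : matrixUnit b p p * matrixUnit b p p = matrixUnit b p p := by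
    rw [matrixUnit_mul, if_pos rfl]
  have hτe := trace_matrixUnit_self b p
  let Φ : CocyclicHom hS hA (hA.tensorRight (Module.End k V)) :=
    traceMap (LinearMap.trace k V) (LinearMap.trace_mul_comm k)
  let Ψ : CocyclicHom hS (hA.tensorRight (Module.End k V)) hA :=
    inclPullback hS hA _ he
  have hΨΦ : ∀ f, Ψ.app n (Φ.app n f) = f := fun f => inclPullback_traceMap _ he hτe f
  have hΦΨ : ∀ f ∈ cyclicCocycles hS (hA.tensorRight (Module.End k V)) n,
      Φ.app n (Ψ.app n f) - f ∈ cyclicCoboundaries hS (hA.tensorRight (Module.End k V)) n :=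
    fun f hf => (isMatrixUnits_matrixUnit b).traceMap_inclPullback_sub_mem _ he hτe hf
  refine ⟨fun ρ => ?_, ?_⟩
  · have hB' := conjEnd_act_of_trivial hr
    -- For trivial `V` the identity of the vector space `A ⊗ End V` is an isomorphism of
    -- `H`-algebras, and pullback along it and its inverse transports the untwisted result.
    let Θ : CocyclicHom hS (hA.tensorRight (Module.End k V)) (ρ.twisted (HAlgebra.conjEnd r)) :=
      pullback (ofTwisted hB' ρ) (intertwines_ofTwisted hB' ρ)
    let Θ' : CocyclicHom hS (ρ.twisted (HAlgebra.conjEnd r)) (hA.tensorRight (Module.End k V)) :=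
      pullback (toTwisted hB' ρ) (intertwines_toTwisted hB' ρ)
    refine ⟨(Θ.comp Φ).equivHC (Ψ.comp Θ') (fun f _ => ?_) (fun f hf => ?_), fun f =>
      ⟨(Θ.comp Φ).onCocycles n f, fun a u g => ?_, CocyclicHom.onHC_mk _ f⟩⟩
    · change Ψ.app n (Φ.app n f) - f ∈ _
      rw [hΨΦ, sub_self]
      exact zero_mem _
    · exact Θ.map_cyclicCoboundaries (hΦΨ _ (Θ'.map_cyclicCocycles hf))
    · exact congr($(traceMap_app_tmul (LinearMap.trace k V) (LinearMap.trace_mul_comm k)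
        f.1 a u) g)
  · refine ⟨Φ.equivHC Ψ (fun f _ => ?_) hΦΨ, fun f =>
      ⟨Φ.onCocycles n f, fun a u g => ?_, CocyclicHom.onHC_mk _ f⟩⟩
    · rw [hΨΦ, sub_self]
      exact zero_mem _
    · exact congr($(traceMap_app_tmul (LinearMap.trace k V) (LinearMap.trace_mul_comm k)
        f.1 a u) g)
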